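/- Here a polytope is the convex hull of finitely many points in some $\mathbb{R}^m$, a $d$-polytope is a polytope of affine dimension $d$, and a facet is a face of dimension one less than the polytope. The extension complexity $\mathrm{xc}(P)$ is the minimal number of facets of a polytope (in any $\mathbb{R}^m$) that some linear map sends onto $P$. Two polytopes are combinatorially equivalent if their face lattices are isomorphic. $\Delta_n$ is the $n$-dimensional simplex, $\times$ is the Cartesian product, and $\mathrm{pyr}_k(R)$ is the $k$-fold pyramid over $R$, the convex hull of $R$ and $k$ further points added successively, each outside the affine hull of the previous ones together with $R$. Let $\pi_d:\mathbb{R}^{d+1}\to\mathbb{R}^d$ be the projection that forgets the last coordinate. A proper face $F$ of a polytope $Q\subset\mathbb{R}^{d+1}$ is strictly preserved under $\pi_d$ if $\pi_d(F)$ is a face of $\pi_d(Q)$, $Q\cap\pi_d^{-1}(\pi_d(F))=F$, and $\dim \pi_d(F)=\dim F$. **Proposition.** Let $P\subset\mathbb{R}^d$ be a $d$-polytope with exactly $d+4$ vertices, at least $d+4$ facets, and $\mathrm{xc}(P)=d+3$. (Then necessarily $d\ge 2$.) Then there is a $(d+1)$-polytope $Q\subset\mathbb{R}^{d+1}$, combinatorially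 equivalent to $\mathrm{pyr}_{d-2}(\Delta_1\times\Delta_2)$, such that $P=\pi_d(Q)$ and every vertex of $Q$ is strictly preserved under $\pi_d$. -/

import Mathlib

namespace FewVertices

/-- A (convex) polytope: the convex hull of a finite set of points. -/
def IsPolytope {E : Type*} [AddCommGroup E] [Module ℝ E] (P : Set E) : Prop :=
  ∃ S : Set E, S.Finite ∧ P = convexHull ℝ S

open Classical in
/-- The affine dimension of a set, with the convention that the empty set has dimension `-1`. -/
noncomputable def polyDim {E : Type*} [AddCommGroup E] [Module ℝ E] (A : Set E) : ℤ :=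
  if A.Nonempty then (Module.finrank ℝ (vectorSpan ℝ A) : ℤ) else -1

/-- The faces of a polytope `P`: the empty set, and the sets of maximizers over `P` of linear
functionals (among them `P` itself, which maximizes the zero functional). -/
def IsFace {E : Type*} [AddCommGroup E] [Module ℝ E] [TopologicalSpace E] (P F : Set E) : Prop :=
  IsExposed ℝ P F

/-- A facet: a face of dimension one less than the polytope. -/
def IsFacet {E : Type*} [AddCommGroup E] [Module ℝ E] [TopologicalSpace E] (P F : Set E) : Prop :=
  IsFace P F ∧ polyDim F + 1 = polyDim P

/-- The number of vertices of a polytope. -/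
noncomputable def numVertices {E : Type*} [AddCommGroup E] [Module ℝ E] (P : Set E) : ℕ :=
  (P.extremePoints ℝ).ncard

/-- The number of facets of a polytope. -/
noncomputable def numFacets {E : Type*} [AddCommGroup E] [Module ℝ E] [TopologicalSpace E]
    (P : Set E) : ℕ :=
  {F : Set E | IsFacet P F}.ncard

/-- The extension complexity of `P`: the least number of facets of a polytope, of any dimension
and in any `ℝ^m`, that a linear map sends onto `P`. -/
noncomputable def extensionComplexity {E : Type*} [AddCommGroup E] [Module ℝ E] (P : Set E) : ℕ :=
  sInf {k : ℕ | ∃ (m : ℕ) (Q : Set (Fin m → ℝ)) (f : (Fin m → ℝ) →ₗ[ℝ] E),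
    IsPolytope Q ∧ f '' Q = P ∧ numFacets Q = k}

/-- Combinatorial equivalence: the face lattices, ordered by inclusion, are isomorphic. -/
def CombEquiv {E F : Type*} [AddCommGroup E] [Module ℝ E] [TopologicalSpace E]
    [AddCommGroup F] [Module ℝ F] [TopologicalSpace F] (P : Set E) (Q : Set F) : Prop :=
  Nonempty ({A : Set E // IsFace P A} ≃o {B : Set F // IsFace Q B})

/-- The `k`-fold pyramid over `P`: the convex hull of a copy of `P` (placed at height `0` in
`E × ℝ^k`) and of `k` apices, the apex number `i` being the point `(0, e_i)`. It arises from `P` by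
adding the apices one after the other, each outside the affine hull of what is already there. -/
def pyr (k : ℕ) {E : Type*} [AddCommGroup E] [Module ℝ E] (P : Set E) : Set (E × (Fin k → ℝ)) :=
  convexHull ℝ ((fun x : E => (x, (0 : Fin k → ℝ))) '' P ∪
    Set.range (fun i : Fin k => ((0 : E), (Pi.single i 1 : Fin k → ℝ))))

/-- The `n`-dimensional simplex, as the standard simplex in `ℝ^(n+1)`. -/
def simplex (n : ℕ) : Set (Fin (n + 1) → ℝ) := stdSimplex ℝ (Fin (n + 1))

/-- The projection `ℝ^(d+1) → ℝ^d` that forgets the last coordinate. -/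
def forgetLast (d : ℕ) : (Fin (d + 1) → ℝ) →ₗ[ℝ] (Fin d → ℝ) :=
  LinearMap.funLeft ℝ ℝ Fin.castSucc

/-- A proper face `G` of `Q` is preserved by `f` if `f(G)` is a face of `f(Q)` whose preimage
in `Q` is `G`. -/
def IsPreserved {E F : Type*} [AddCommGroup E] [Module ℝ E] [TopologicalSpace E]
    [AddCommGroup F] [Module ℝ F] [TopologicalSpace F] (f : E →ₗ[ℝ] F) (Q G : Set E) : Prop :=
  IsFace Q G ∧ G ≠ Q ∧ IsFace (f '' Q) (f '' G) ∧ Q ∩ f ⁻¹' (f '' G) = G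

/-- A preserved face is strictly preserved if its image has the same dimension. -/
def IsStrictlyPreserved {E F : Type*} [AddCommGroup E] [Module ℝ E] [TopologicalSpace E]
    [AddCommGroup F] [Module ℝ F] [TopologicalSpace F] (f : E →ₗ[ℝ] F) (Q G : Set E) : Prop :=
  IsPreserved f Q G ∧ polyDim (f '' G) = polyDim G

end FewVertices

/-! Let R be a polytope with d+3 facets mapping onto P. After homogenization, the cone over R is cut
out of its span V by the facet functionals, which form an injective map Y : V → ℝ^(d+3), and (π, τ)
maps V onto ℝ^(d+1) (`exists_coneExtension`). If dim V = d+1, then P inherits the d+3 inequalities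
and has too few facets. If dim V = d+3, the cone is an orthant and P has too few vertices. So dim V
= d+2: the cone is the slice of the orthant by a hyperplane ∑ a_i s_i = 0, and (π, τ) has a
one-dimensional kernel ℝl.

Let k, A, B count the zero, positive and negative a_i. The slice has k + AB extreme rays, supported
on one zero index or on two indices of opposite sign, and every vertex of P lifts to a ray. The
support of an unused ray contains all positive or all negative coordinates of Y l
(`subset_raySupp_of_notMem_range`). Let p and q be the sizes of these two sign classes.
Fourier-Motzkin elimination of l and the facet bound give pq ≥ p+q+1, so p, q ≥ 2 and not both are
2. Since supports have at most two elements, at most one ray is unused (`notMem_range_vertexRay`).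

Hence k + AB is d+4 or d+5 while k + A + B = d+3, so (A-1)(B-1) is 2 or 3. Up to the sign of a, A =
2 and B is 3 or 4. In both cases the used rays span a (d-2)-fold pyramid over a 2 × 3 prism; for B =
4 the partner of the unused ray becomes one more apex (`exists_prism_of_card_eq_two`). Lifting the
vertices of P by a functional that is nonzero at l produces Q (`exists_polytope_of_prism`). -/

namespace FewVertices

open Set Module

/-! ### Homogenization: polytopes as sections of cones. -/

section Homogenization

variable {E : Type*} [AddCommGroup E] [Module ℝ E]

theorem mem_convexHull_range {ι : Type*} [Fintype ι] {q : ι → E} {x : E} :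
    x ∈ convexHull ℝ (range q) ↔
      ∃ w : ι → ℝ, (∀ i, 0 ≤ w i) ∧ ∑ i, w i = 1 ∧ ∑ i, w i • q i = x := by
  classical
  have h : convexHull ℝ (range q) =
      ⇑(∑ i : ι, (LinearMap.proj (R := ℝ) (φ := fun _ : ι => ℝ) i).smulRight (q i)) ''
        stdSimplex ℝ ι := by
    rw [← convexHull_basis_eq_stdSimplex, LinearMap.image_convexHull, ← range_comp]
    congr 2
    ext i
    simp
  rw [h]
  simp [stdSimplex, and_assoc]

/-- The point at height `1` over `x`. -/
def homog (x : E) : E × ℝ := (x, 1)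

/-- A functional on `E × ℝ` that is nonnegative on the generators of a polytope is nonnegative. -/
theorem nonneg_on_convexHull {s : Set E} {y : E × ℝ →ₗ[ℝ] ℝ} (h : ∀ x ∈ s, 0 ≤ y (homog x))
    {x : E} (hx : x ∈ convexHull ℝ s) : 0 ≤ y (homog x) := by
  have hc : Convex ℝ {x : E | 0 ≤ y (homog x)} := by
    intro a ha b hb u v hu hv huv
    have : homog (u • a + v • b) = u • homog a + v • homog b := by
      simp [homog, huv]
    simp only [mem_ofPred_eq, this, map_add, map_smul, smul_eq_mul] at *
    positivity
  exact convexHull_min (fun x hx => h x hx) hc hx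

theorem homog_sum {ι : Type*} [Fintype ι] {q : ι → E} {w : ι → ℝ} (hw : ∑ i, w i = 1) :
    homog (∑ i, w i • q i) = ∑ i, w i • homog (q i) := by
  ext
  · simp [homog, Prod.fst_sum]
  · simp [homog, Prod.snd_sum, hw]

/-- A point of a polytope at which a nonnegative functional vanishes is a convex combination of
generators at which it vanishes. -/
theorem mem_convexHull_zeros {ι : Type*} [Fintype ι] {q : ι → E} {y : E × ℝ →ₗ[ℝ] ℝ}
    (h : ∀ i, 0 ≤ y (homog (q i))) {x : E} (hx : x ∈ convexHull ℝ (range q))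
    (hy : y (homog x) = 0) : x ∈ convexHull ℝ (q '' {i | y (homog (q i)) = 0}) := by
  obtain ⟨w, hw0, hw1, rfl⟩ := mem_convexHull_range.1 hx
  rw [homog_sum hw1, map_sum] at hy
  have h0 : ∀ i, w i * y (homog (q i)) = 0 := by
    have := (Finset.sum_eq_zero_iff_of_nonneg (s := Finset.univ)
      (f := fun i => y (w i • homog (q i))) (fun i _ => by
        simpa using mul_nonneg (hw0 i) (h i))).1 hy
    intro i
    simpa using this i (Finset.mem_univ i)
  classical
  have hs : ∀ i ∉ Finset.univ.filter (fun i => w i ≠ 0), w i = 0 := by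
    intro i hi; simpa using hi
  have e1 : ∑ i, w i • q i = ∑ i ∈ Finset.univ.filter (fun i => w i ≠ 0), w i • q i := by
    symm
    apply Finset.sum_subset (Finset.subset_univ _)
    intro i _ hi
    rw [hs i hi, zero_smul]
  have e2 : ∑ i ∈ Finset.univ.filter (fun i => w i ≠ 0), w i = 1 := by
    rw [← hw1]
    apply Finset.sum_subset (Finset.subset_univ _)
    intro i _ hi
    exact hs i hi
  rw [e1]
  apply (convex_convexHull ℝ _).sum_mem (fun i _ => hw0 i) e2
  intro i hi
  apply subset_convexHull
  refine ⟨i, ?_, rfl⟩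
  have : w i ≠ 0 := by simpa using hi
  exact (mul_eq_zero.1 (h0 i)).resolve_left this

theorem homog_mem_span_convexHull {s : Set E} {x : E} (hx : x ∈ convexHull ℝ s) :
    homog x ∈ Submodule.span ℝ (homog '' s) := by
  have hc : Convex ℝ {x : E | homog x ∈ Submodule.span ℝ (homog '' s)} := by
    intro a ha b hb u v hu hv huv
    have : homog (u • a + v • b) = u • homog a + v • homog b := by
      simp [homog, huv]
    rw [mem_ofPred_eq] at ha hb ⊢
    rw [this]
    exact Submodule.add_mem _ (Submodule.smul_mem _ _ ha) (Submodule.smul_mem _ _ hb)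
  exact convexHull_min (t := {x : E | homog x ∈ Submodule.span ℝ (homog '' s)})
    (fun x hx => Submodule.subset_span (mem_image_of_mem homog hx)) hc hx

theorem span_homog_convexHull (s : Set E) :
    Submodule.span ℝ (homog '' convexHull ℝ s) = Submodule.span ℝ (homog '' s) := by
  apply le_antisymm
  · rw [Submodule.span_le]
    rintro _ ⟨x, hx, rfl⟩
    exact homog_mem_span_convexHull hx
  · exact Submodule.span_mono (image_mono (subset_convexHull ℝ s))

/-- Turns dimension counts into linear algebra. The convention -1 for the empty set is what makes
the formula hold there too. -/
theorem polyDim_eq_finrank [FiniteDimensional ℝ E] (s : Set E) :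
    polyDim s + 1 = finrank ℝ (Submodule.span ℝ (homog '' s)) := by
  rcases s.eq_empty_or_nonempty with rfl | ⟨x0, hx0⟩
  · rw [polyDim, if_neg Set.not_nonempty_empty, image_empty, Submodule.span_empty, finrank_bot]
    simp
  have key : Submodule.span ℝ (homog '' s) =
      (vectorSpan ℝ s).map (LinearMap.inl ℝ E ℝ) ⊔ Submodule.span ℝ {homog x0} := by
    apply le_antisymm
    · rw [Submodule.span_le]
      rintro _ ⟨x, hx, rfl⟩
      refine Submodule.mem_sup.2 ⟨(x - x0, 0), ⟨x - x0, vsub_mem_vectorSpan ℝ hx hx0, rfl⟩,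
        homog x0, Submodule.mem_span_singleton_self _, ?_⟩
      simp [homog]
    · apply sup_le
      · rw [vectorSpan_eq_span_vsub_set_right ℝ hx0, Submodule.map_span, Submodule.span_le]
        rintro _ ⟨_, ⟨x, hx, rfl⟩, rfl⟩
        have : (LinearMap.inl ℝ E ℝ) (x -ᵥ x0) = homog x - homog x0 := by simp [homog]
        simp only [this, SetLike.mem_coe]
        exact Submodule.sub_mem _ (Submodule.subset_span ⟨x, hx, rfl⟩)
          (Submodule.subset_span ⟨x0, hx0, rfl⟩)
      · exact Submodule.span_mono (by simpa using mem_image_of_mem homog hx0)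
  have hd : Disjoint ((vectorSpan ℝ s).map (LinearMap.inl ℝ E ℝ))
      (Submodule.span ℝ {homog x0}) := by
    rw [Submodule.disjoint_def]
    rintro _ ⟨v, _, rfl⟩ h
    obtain ⟨c, hc⟩ := Submodule.mem_span_singleton.1 h
    have h2 := congrArg Prod.snd hc
    have : c = 0 := by simpa [homog] using h2
    rw [← hc, this, zero_smul]
  have hf := Submodule.finrank_sup_add_finrank_inf_eq
    ((vectorSpan ℝ s).map (LinearMap.inl ℝ E ℝ)) (Submodule.span ℝ {homog x0})
  rw [hd.eq_bot, finrank_bot, add_zero, finrank_span_singleton (by simp [homog]),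
    ((Submodule.equivMapOfInjective _ LinearMap.inl_injective
      (vectorSpan ℝ s)).finrank_eq).symm] at hf
  rw [key, hf, polyDim, if_pos ⟨x0, hx0⟩]
  push_cast
  rfl

end Homogenization

/-! ### Faces as zero sets of nonnegative functionals. -/

section Faces

variable {E : Type*} [AddCommGroup E] [Module ℝ E] [TopologicalSpace E]

theorem IsFace.exists_functional {P F : Set E} (hF : IsFace P F) (hne : F.Nonempty) :
    ∃ y : E × ℝ →ₗ[ℝ] ℝ, (∀ x ∈ P, 0 ≤ y (homog x)) ∧ F = {x ∈ P | y (homog x) = 0} := by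
  obtain ⟨l, hl⟩ := hF hne
  obtain ⟨x0, hx0⟩ := hne
  have hx0' : x0 ∈ P ∧ ∀ y ∈ P, l y ≤ l x0 := by rw [hl] at hx0; exact hx0
  refine ⟨(LinearMap.toSpanSingleton ℝ ℝ (l x0)).comp (LinearMap.snd ℝ E ℝ) -
    (l : E →ₗ[ℝ] ℝ).comp (LinearMap.fst ℝ E ℝ), ?_, ?_⟩
  · intro x hx
    simpa [homog] using hx0'.2 x hx
  · rw [hl]
    ext x
    simp only [homog, mem_ofPred_eq, LinearMap.sub_apply, LinearMap.comp_apply, LinearMap.snd_apply,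
      LinearMap.toSpanSingleton_apply, LinearMap.fst_apply, one_smul, sub_eq_zero]
    refine and_congr_right fun hx => ⟨fun h => le_antisymm (h x0 hx0'.1) (hx0'.2 x hx), ?_⟩
    intro h y hy
    exact (hx0'.2 y hy).trans h.le

theorem isFace_of_functional [IsTopologicalAddGroup E] [ContinuousSMul ℝ E] [T2Space E]
    [FiniteDimensional ℝ E] {P : Set E} {y : E × ℝ →ₗ[ℝ] ℝ} (h : ∀ x ∈ P, 0 ≤ y (homog x)) :
    IsFace P {x ∈ P | y (homog x) = 0} := by
  rintro ⟨x0, hx0, hy0⟩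
  refine ⟨LinearMap.toContinuousLinearMap (-(y.comp (LinearMap.inl ℝ E ℝ))), ?_⟩
  have hy : ∀ x, y (homog x) = y (x, 0) + y (0, 1) := by
    intro x
    rw [← map_add]
    simp [homog]
  ext x
  refine and_congr_right fun hx => ?_
  simp only [LinearMap.coe_toContinuousLinearMap', LinearMap.neg_apply, LinearMap.comp_apply,
    LinearMap.inl_apply, neg_le_neg_iff]
  constructor
  · intro hx z hz
    have := h z hz
    rw [hy] at this hx
    linarith
  · intro hz
    have h1 := hz x0 hx0
    have h2 := h x hx
    rw [hy] at hy0 h2 ⊢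
    linarith

theorem convexHull_finite_compact [IsTopologicalAddGroup E] [ContinuousSMul ℝ E]
    {ι : Type*} [Finite ι] (q : ι → E) : IsCompact (convexHull ℝ (range q)) :=
  (finite_range q).isCompact_convexHull ℝ

/-- A vertex of a polytope is a face. -/
theorem isFace_singleton_of_extreme [IsTopologicalAddGroup E] [ContinuousSMul ℝ E] [T2Space E]
    [LocallyConvexSpace ℝ E] {P : Set E} (hP : IsPolytope P) {p : E}
    (hp : p ∈ P.extremePoints ℝ) : IsFace P {p} := by
  obtain ⟨S, hS, rfl⟩ := hP
  have hpS : p ∈ S := extremePoints_convexHull_subset hp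
  have hn : p ∉ convexHull ℝ (S \ {p}) := by
    intro h
    have : p ∈ (convexHull ℝ (S \ {p})).extremePoints ℝ :=
      inter_extremePoints_subset_extremePoints_of_subset
        (convexHull_mono sdiff_subset) ⟨h, hp⟩
    exact (extremePoints_convexHull_subset this).2 rfl
  -- A functional separating p from the hull of the other generators has p as its only maximizer.
  obtain ⟨f, u, h1, h2⟩ := geometric_hahn_banach_closed_point (convex_convexHull ℝ _)
    ((hS.subset sdiff_subset).isCompact_convexHull ℝ).isClosed hn
  intro _
  refine ⟨f, ?_⟩
  have hle : ∀ y ∈ convexHull ℝ S, f y ≤ f p := by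
    intro y hy
    have hc : Convex ℝ {y | f y ≤ f p} := convex_halfSpace_le f.isLinear _
    refine convexHull_min ?_ hc hy
    intro z hz
    by_cases h : z = p
    · simp [h]
    · exact ((h1 z (subset_convexHull _ _ ⟨hz, h⟩)).trans h2).le
  ext x
  simp only [mem_singleton_iff, mem_ofPred_eq]
  constructor
  · rintro rfl
    exact ⟨hp.1, hle⟩
  · rintro ⟨hx, hx'⟩
    have hxp : f x = f p := le_antisymm (hle x hx) (hx' p hp.1)
    by_cases hne : (S \ {p}).Nonempty
    · rw [← insert_sdiff_self_of_mem hpS, convexHull_insert hne, mem_convexJoin] at hx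
      obtain ⟨a, rfl, b, hb, hx⟩ := hx
      obtain ⟨s, t, hs, ht, hst, rfl⟩ := hx
      have hfb := h1 b hb
      rw [map_add, map_smul, map_smul, smul_eq_mul, smul_eq_mul] at hxp
      have : t = 0 := by
        by_contra h0
        have : 0 < t := lt_of_le_of_ne ht (Ne.symm h0)
        have hs' : s = 1 - t := by linarith
        subst hs'
        nlinarith
      subst this
      have : s = 1 := by linarith
      simp [this]
    · rw [not_nonempty_iff_eq_empty, sdiff_eq_empty] at hne
      have : S = {p} := hne.antisymm (by simpa using hpS)
      simpa [this] using hx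

end Faces

theorem finrank_inf_ker_add_one {W : Type*} [AddCommGroup W] [Module ℝ W] [FiniteDimensional ℝ W]
    (V : Submodule ℝ W) (y : W →ₗ[ℝ] ℝ) {v : W} (hv : v ∈ V) (hy : y v ≠ 0) :
    finrank ℝ (V ⊓ LinearMap.ker y : Submodule ℝ W) + 1 = finrank ℝ V := by
  have h := LinearMap.finrank_range_add_finrank_ker (y.domRestrict V)
  have hr : LinearMap.range (y.domRestrict V) = ⊤ :=
    LinearMap.range_eq_top.2 (LinearMap.surjective (fun h0 => hy (by
      simpa using LinearMap.congr_fun h0 ⟨v, hv⟩)))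
  rw [hr, finrank_top, finrank_self, ← Submodule.finrank_map_subtype_eq] at h
  have he : (LinearMap.ker (y.domRestrict V)).map V.subtype = V ⊓ LinearMap.ker y := by
    ext x
    simp only [Submodule.mem_map, LinearMap.mem_ker, LinearMap.domRestrict_apply,
      Submodule.subtype_apply, Subtype.exists, exists_and_right, exists_eq_right,
      Submodule.mem_inf]
    exact ⟨fun ⟨h, h'⟩ => ⟨h, by simpa using h'⟩, fun ⟨h, h'⟩ => ⟨h, by simpa using h'⟩⟩
  rw [he] at h
  omega

/-- A functional that is nonnegative on a finite spanning family and negative at `v` can be chosen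
such that its kernel is spanned by the members of the family at which it vanishes. -/
theorem exists_extremal_functional {W ι : Type*} [AddCommGroup W] [Module ℝ W] [Finite ι]
    {w : ι → W} {v : W} {y : W →ₗ[ℝ] ℝ} (hy : ∀ i, 0 ≤ y (w i)) (hv : y v < 0) :
    ∃ z : W →ₗ[ℝ] ℝ, (∀ i, 0 ≤ z (w i)) ∧ z v < 0 ∧
      ∀ x ∈ Submodule.span ℝ (range w), z x = 0 →
        x ∈ Submodule.span ℝ (w '' {i | z (w i) = 0}) := by
  obtain ⟨n, hn⟩ : ∃ n, n = {i | y (w i) ≠ 0}.ncard := ⟨_, rfl⟩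
  induction n using Nat.strong_induction_on generalizing y with
  | _ n ih =>
    by_cases hgood : ∀ x ∈ Submodule.span ℝ (range w), y x = 0 →
        x ∈ Submodule.span ℝ (w '' {i | y (w i) = 0})
    · exact ⟨y, hy, hv, hgood⟩
    push Not at hgood
    obtain ⟨x, hxV, hyx, hxU⟩ := hgood
    obtain ⟨ψ, hψx, hψ⟩ := Submodule.exists_le_ker_of_notMem hxU
    have hψ0 : ∀ i, y (w i) = 0 → ψ (w i) = 0 := fun i hi =>
      hψ (Submodule.subset_span ⟨i, hi, rfl⟩)
    obtain ⟨χ, hχ0, hχv, i1, hi1⟩ : ∃ χ : W →ₗ[ℝ] ℝ, (∀ i, y (w i) = 0 → χ (w i) = 0) ∧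
        χ v = 0 ∧ ∃ i, χ (w i) < 0 := by
      -- Correcting ψ by a multiple of y makes it vanish at v, so moving y along χ keeps the value
      -- at v negative.
      let χ : W →ₗ[ℝ] ℝ := ψ - (ψ v / y v) • y
      have h1 : ∀ i, y (w i) = 0 → χ (w i) = 0 := by
        intro i hi
        simp [χ, hi, hψ0 i hi]
      have h2 : χ v = 0 := by
        simp [χ, div_mul_cancel₀ _ hv.ne]
      have h3 : χ x ≠ 0 := by
        simpa [χ, hyx] using hψx
      have h4 : ∃ i, χ (w i) ≠ 0 := by
        by_contra hcon
        push Not at hcon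
        apply h3
        have : Submodule.span ℝ (range w) ≤ LinearMap.ker χ := by
          rw [Submodule.span_le]
          rintro _ ⟨i, rfl⟩
          exact hcon i
        exact this hxV
      obtain ⟨i, hi⟩ := h4
      rcases lt_or_gt_of_ne hi with hlt | hgt
      · exact ⟨χ, h1, h2, i, hlt⟩
      · refine ⟨-χ, fun j hj => by simp [h1 j hj], by simp [h2], i, by simpa using hgt⟩
    obtain ⟨i0, hi0, hmin⟩ := (toFinite {i | χ (w i) < 0}).exists_minimalFor
      (fun i => y (w i) / -χ (w i)) _ ⟨i1, hi1⟩
    rw [mem_ofPred_eq] at hi0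
    -- The first t at which y + tχ acquires a new zero on the family. All old zeros persist, so the
    -- number of nonzero values drops.
    set t := y (w i0) / -χ (w i0) with ht
    have ht0 : 0 ≤ t := div_nonneg (hy i0) (by linarith)
    have hmin' : ∀ i, χ (w i) < 0 → t ≤ y (w i) / -χ (w i) := fun i hi => by
      rcases le_total t (y (w i) / -χ (w i)) with h | h
      · exact h
      · exact hmin hi h
    have hy' : ∀ i, 0 ≤ (y + t • χ) (w i) := by
      intro i
      simp only [LinearMap.add_apply, LinearMap.smul_apply, smul_eq_mul]
      rcases lt_or_ge (χ (w i)) 0 with h | h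
      · have := (le_div_iff₀ (by linarith)).1 (hmin' i h)
        linarith
      · have := hy i
        positivity
    refine ih _ ?_ hy' (by simpa [hχv] using hv) rfl
    rw [hn]
    apply ncard_lt_ncard _ (toFinite _)
    refine ⟨fun i hi hi' => hi ?_, fun hsub => ?_⟩
    · simp [hi', hχ0 i hi']
    · have h1 : y (w i0) ≠ 0 := fun h => hi0.ne (hχ0 i0 h)
      apply hsub h1
      have : χ (w i0) ≠ 0 := hi0.ne
      simp only [LinearMap.add_apply, LinearMap.smul_apply, smul_eq_mul, ht]
      field_simp
      simp

theorem IsFacet.nonempty {E : Type*} [AddCommGroup E] [Module ℝ E]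
    [TopologicalSpace E] {P F : Set E} (hF : IsFacet P F)
    (hd : 0 < polyDim P) : F.Nonempty := by
  by_contra h
  have := hF.2
  rw [polyDim, if_neg h] at this
  omega

/-! ### Facets cut a polytope out of its affine hull. -/

section Representation

variable {E : Type*} [NormedAddCommGroup E] [NormedSpace ℝ E] [FiniteDimensional ℝ E]
  {ι : Type*}

/-- A point outside the cone over a polytope is separated from it. -/
theorem exists_separating_functional [Fintype ι] [Nonempty ι] {q : ι → E} {v : E × ℝ}
    (hv : ¬ ∃ w : ι → ℝ, (∀ i, 0 ≤ w i) ∧ v = ∑ i, w i • homog (q i)) :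
    ∃ y : E × ℝ →ₗ[ℝ] ℝ, (∀ i, 0 ≤ y (homog (q i))) ∧ y v < 0 := by
  obtain ⟨x, t⟩ := v
  rcases lt_trichotomy t 0 with ht | rfl | ht
  · exact ⟨LinearMap.snd ℝ E ℝ, fun i => by simp [homog], ht⟩
  · have hx : x ≠ 0 := by
      rintro rfl
      exact hv ⟨0, by simp, by simp⟩
    obtain ⟨f, hf⟩ : ∃ f : E →ₗ[ℝ] ℝ, f x < 0 := by
      obtain ⟨f, hf⟩ : ∃ f : Dual ℝ E, f x ≠ 0 := by
        by_contra h
        push Not at h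
        exact hx ((forall_dual_apply_eq_zero_iff ℝ x).1 h)
      rcases lt_or_gt_of_ne hf with h | h
      · exact ⟨f, h⟩
      · exact ⟨-f, by simpa using h⟩
    -- At height 0 only f acts on v, while M at height 1 outweighs f on every generator.
    let M := ∑ i, |f (q i)|
    refine ⟨f.comp (LinearMap.fst ℝ E ℝ) + M • LinearMap.snd ℝ E ℝ, fun i => ?_, ?_⟩
    · have h1 : |f (q i)| ≤ M :=
        Finset.single_le_sum (f := fun i => |f (q i)|) (fun i _ => abs_nonneg _) (Finset.mem_univ i)
      have h2 := neg_abs_le (f (q i))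
      simp [homog]
      linarith
    · simpa using hf
  · have hn : t⁻¹ • x ∉ convexHull ℝ (range q) := by
      intro h
      obtain ⟨w, h0, h1, h2⟩ := mem_convexHull_range.1 h
      refine hv ⟨fun i => t * w i, fun i => mul_nonneg ht.le (h0 i), ?_⟩
      have : ∑ i, (t * w i) • homog (q i) = t • homog (∑ i, w i • q i) := by
        rw [homog_sum h1, Finset.smul_sum]
        simp [mul_smul]
      rw [this, h2]
      ext <;> simp [homog, ht.ne']
    obtain ⟨f, u, h1, h2⟩ := geometric_hahn_banach_closed_point (convex_convexHull ℝ _)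
      (convexHull_finite_compact q).isClosed hn
    refine ⟨u • LinearMap.snd ℝ E ℝ - (f : E →ₗ[ℝ] ℝ).comp (LinearMap.fst ℝ E ℝ), fun i => ?_, ?_⟩
    · have := h1 (q i) (subset_convexHull _ _ ⟨i, rfl⟩)
      simp [homog, this.le]
    · rw [map_smul, smul_eq_mul, lt_inv_mul_iff₀ ht] at h2
      simpa [mul_comm] using h2

/-- When the zero set spans the whole kernel of y inside the span, its rank is exactly one less. -/
theorem isFacet_of_functional {q : ι → E} {y : E × ℝ →ₗ[ℝ] ℝ} (h : ∀ i, 0 ≤ y (homog (q i)))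
    {v : E × ℝ} (hvV : v ∈ Submodule.span ℝ (homog '' range q)) (hv : y v ≠ 0)
    (hz : ∀ x ∈ Submodule.span ℝ (homog '' range q), y x = 0 →
      x ∈ Submodule.span ℝ (homog '' (q '' {i | y (homog (q i)) = 0}))) :
    IsFacet (convexHull ℝ (range q)) {x ∈ convexHull ℝ (range q) | y (homog x) = 0} ∧
    ∀ x ∈ Submodule.span ℝ (homog '' range q), y x = 0 →
      x ∈ Submodule.span ℝ (homog '' {x ∈ convexHull ℝ (range q) | y (homog x) = 0}) := by
  have hz' : ∀ x ∈ Submodule.span ℝ (homog '' range q), y x = 0 →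
      x ∈ Submodule.span ℝ (homog '' {x ∈ convexHull ℝ (range q) | y (homog x) = 0}) := by
    intro x hx hx0
    refine Submodule.span_mono (image_mono ?_) (hz x hx hx0)
    rintro _ ⟨i, hi, rfl⟩
    exact ⟨subset_convexHull _ _ ⟨i, rfl⟩, hi⟩
  refine ⟨⟨isFace_of_functional fun x hx => nonneg_on_convexHull ?_ hx, ?_⟩, hz'⟩
  · rintro _ ⟨i, rfl⟩
    exact h i
  have e : Submodule.span ℝ (homog '' {x ∈ convexHull ℝ (range q) | y (homog x) = 0}) =
      Submodule.span ℝ (homog '' range q) ⊓ LinearMap.ker y := by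
    apply le_antisymm
    · rw [Submodule.span_le]
      rintro _ ⟨x, ⟨hx, hx0⟩, rfl⟩
      exact ⟨homog_mem_span_convexHull hx, hx0⟩
    · rintro x ⟨hx, hx0⟩
      exact hz' x hx hx0
  have h1 := finrank_inf_ker_add_one _ y hvV hv
  rw [← e] at h1
  have h2 := polyDim_eq_finrank {x ∈ convexHull ℝ (range q) | y (homog x) = 0}
  have h3 := polyDim_eq_finrank (convexHull ℝ (range q))
  rw [span_homog_convexHull] at h3
  omega

/-- A polytope of positive dimension is cut out of its affine hull by its facets. -/
theorem exists_facet_functionals [Fintype ι] (q : ι → E) (hd : 0 < polyDim (convexHull ℝ (range q))) :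
    ∃ Y : {F : Set E // IsFacet (convexHull ℝ (range q)) F} → (E × ℝ →ₗ[ℝ] ℝ),
      (∀ F, ∀ x ∈ convexHull ℝ (range q), 0 ≤ Y F (homog x)) ∧
      ∀ v ∈ Submodule.span ℝ (homog '' range q), (∀ F, 0 ≤ Y F v) →
        ∃ w : ι → ℝ, (∀ i, 0 ≤ w i) ∧ v = ∑ i, w i • homog (q i) := by
  have hι : Nonempty ι := by
    by_contra h
    rw [not_nonempty_iff] at h
    simp [polyDim, range_eq_empty] at hd
  choose Y hY0 hYF using fun F : {F : Set E // IsFacet (convexHull ℝ (range q)) F} =>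
    F.2.1.exists_functional (F.2.nonempty hd)
  refine ⟨Y, hY0, fun v hvV hv => ?_⟩
  by_contra hcon
  obtain ⟨y0, hy0, hy0v⟩ := exists_separating_functional hcon
  obtain ⟨y, hy, hyv, hspan⟩ := exists_extremal_functional (w := fun i => homog (q i)) hy0 hy0v
  have e1 : range (fun i => homog (q i)) = homog '' range q := range_comp homog q
  have e2 : (fun i => homog (q i)) '' {i | y (homog (q i)) = 0} =
    homog '' (q '' {i | y (homog (q i)) = 0}) := image_comp homog q _
  rw [e1, e2] at hspan
  obtain ⟨hfac, hspan'⟩ := isFacet_of_functional hy hvV hyv.ne hspan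
  set F : {F : Set E // IsFacet (convexHull ℝ (range q)) F} := ⟨_, hfac⟩ with hFdef
  have hFeq := hYF F
  obtain ⟨i, hi⟩ : ∃ i, y (homog (q i)) ≠ 0 := by
    by_contra hall
    push Not at hall
    have : Submodule.span ℝ (homog '' range q) ≤ LinearMap.ker y := by
      rw [Submodule.span_le]
      rintro _ ⟨_, ⟨i, rfl⟩, rfl⟩
      exact hall i
    exact hyv.ne (this hvV)
  have hipos : 0 < y (homog (q i)) := lt_of_le_of_ne (hy i) (Ne.symm hi)
  have hqi : q i ∈ convexHull ℝ (range q) := subset_convexHull _ _ ⟨i, rfl⟩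
  have hYi : 0 < Y F (homog (q i)) := by
    refine lt_of_le_of_ne (hY0 F _ hqi) fun h => hi ?_
    have : q i ∈ (F : Set E) := by
      rw [hFeq]
      exact ⟨hqi, h.symm⟩
    exact this.2
  -- This combination lies in the span of the facet, so `Y F` kills it as well. That makes a
  -- nonnegative multiple of `Y F v` equal to a negative number.
  have hu : y ((y (homog (q i))) • v - (y v) • homog (q i)) = 0 := by
    simp [mul_comm]
  have hmem := hspan' _ (Submodule.sub_mem _ (Submodule.smul_mem _ _ hvV)
    (Submodule.smul_mem _ _ (Submodule.subset_span ⟨q i, ⟨i, rfl⟩, rfl⟩))) hu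
  have hker : Submodule.span ℝ (homog '' (F : Set E)) ≤ LinearMap.ker (Y F) := by
    rw [Submodule.span_le]
    rintro _ ⟨x, hx, rfl⟩
    rw [hFeq] at hx
    exact hx.2
  have h0 := hker hmem
  rw [LinearMap.mem_ker, map_sub, map_smul, map_smul, smul_eq_mul, smul_eq_mul] at h0
  have h1 := mul_nonneg hipos.le (hv F)
  have h2 := mul_neg_of_neg_of_pos hyv hYi
  linarith

end Representation

/-! ### Cone extensions, and facet counts from inequalities. -/

/-- A polyhedral cone in `V` cut out by the functionals `Y`, that is strictly positive for `τ` and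
has the polytope `P` as the projection by `π` of its section at `τ = 1`. -/
structure ConeExtension {d : ℕ} (P : Set (Fin d → ℝ)) (κ V : Type*) [AddCommGroup V]
    [Module ℝ V] where
  Y : V →ₗ[ℝ] (κ → ℝ)
  π : V →ₗ[ℝ] (Fin d → ℝ)
  τ : V →ₗ[ℝ] ℝ
  pos : ∀ v, 0 ≤ Y v → v ≠ 0 → 0 < τ v
  proj : ∀ x, x ∈ P ↔ ∃ v, 0 ≤ Y v ∧ τ v = 1 ∧ π v = x
  surj : Function.Surjective (π.prod τ)

/-- Passing to the span of the homogenized Q removes the equations of its affine hull, so the facet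
functionals alone describe the cone. Surjectivity comes from the full dimension of P. -/
theorem exists_coneExtension {d m : ℕ} {P : Set (Fin d → ℝ)} {Q : Set (Fin m → ℝ)}
    {f : (Fin m → ℝ) →ₗ[ℝ] (Fin d → ℝ)} (hQ : IsPolytope Q) (hf : f '' Q = P)
    (hdim : polyDim P = d) (hd : 1 ≤ d) :
    Nonempty (ConeExtension P {F : Set (Fin m → ℝ) // IsFacet Q F}
      (Submodule.span ℝ (homog '' Q))) := by
  obtain ⟨S, hS, rfl⟩ := hQ
  obtain ⟨ι, hι, q, rfl⟩ : ∃ (ι : Type) (_ : Fintype ι) (q : ι → (Fin m → ℝ)), range q = S :=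
    ⟨S, hS.fintype, Subtype.val, Subtype.range_val⟩
  set V := Submodule.span ℝ (homog '' convexHull ℝ (range q)) with hV
  let π : V →ₗ[ℝ] (Fin d → ℝ) := f.comp ((LinearMap.fst ℝ _ ℝ).comp V.subtype)
  let τ : V →ₗ[ℝ] ℝ := (LinearMap.snd ℝ _ ℝ).comp V.subtype
  have hsurj : Function.Surjective (π.prod τ) := by
    rw [← LinearMap.range_eq_top]
    have h1 : Submodule.span ℝ (homog '' P) ≤ LinearMap.range (π.prod τ) := by
      rw [Submodule.span_le]
      rintro _ ⟨x, hx, rfl⟩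
      rw [← hf] at hx
      obtain ⟨z, hz, rfl⟩ := hx
      exact ⟨⟨homog z, Submodule.subset_span ⟨z, hz, rfl⟩⟩, rfl⟩
    have h2 := polyDim_eq_finrank P
    have h3 : Submodule.span ℝ (homog '' P) = ⊤ := by
      apply Submodule.eq_top_of_finrank_eq
      simp
      omega
    rw [h3] at h1
    exact top_le_iff.1 h1
  have hfin : d + 1 ≤ finrank ℝ V := by
    have := LinearMap.finrank_le_finrank_of_surjective hsurj
    simpa using this
  have hdimQ := polyDim_eq_finrank (convexHull ℝ (range q))
  rw [← hV] at hdimQ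
  obtain ⟨Y, hY, hYc⟩ := exists_facet_functionals q (by omega)
  have hcone : ∀ v : V, (∀ F, 0 ≤ Y F v) →
      ∃ w : _ → ℝ, (∀ i, 0 ≤ w i) ∧ (v : (Fin m → ℝ) × ℝ) = ∑ i, w i • homog (q i) := by
    rintro ⟨v, hv⟩ h
    refine hYc v ?_ h
    rw [hV, span_homog_convexHull] at hv
    exact hv
  have hsnd : ∀ w : ι → ℝ, (∑ i, w i • homog (q i)).2 = ∑ i, w i := by
    intro w
    simp [Prod.snd_sum, homog]
  refine ⟨⟨LinearMap.pi fun F => (Y F).comp V.subtype, π, τ, ?_, ?_, hsurj⟩⟩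
  · intro v hv hv0
    obtain ⟨w, hw, hvw⟩ := hcone v hv
    have hτ : τ v = ∑ i, w i := by
      simp only [τ, LinearMap.comp_apply, Submodule.subtype_apply, hvw, LinearMap.snd_apply, hsnd]
    rw [hτ]
    refine lt_of_le_of_ne (Finset.sum_nonneg fun i _ => hw i) fun h => hv0 ?_
    have h0 := (Finset.sum_eq_zero_iff_of_nonneg fun i _ => hw i).1 h.symm
    ext1
    rw [hvw]
    simp [h0]
  · intro x
    constructor
    · intro hx
      rw [← hf] at hx
      obtain ⟨z, hz, rfl⟩ := hx
      exact ⟨⟨homog z, Submodule.subset_span ⟨z, hz, rfl⟩⟩, fun F => hY F z hz, rfl, rfl⟩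
    · rintro ⟨v, hv, hv1, rfl⟩
      obtain ⟨w, hw, hvw⟩ := hcone v hv
      have hτ : τ v = ∑ i, w i := by
        simp only [τ, LinearMap.comp_apply, Submodule.subtype_apply, hvw, LinearMap.snd_apply, hsnd]
      rw [hτ] at hv1
      rw [← homog_sum hv1] at hvw
      rw [← hf]
      refine ⟨_, mem_convexHull_range.2 ⟨w, hw, hv1, rfl⟩, ?_⟩
      simp [π, hvw, homog]

/-- A facet of a polytope given by finitely many inequalities is cut out by one of them. -/
theorem IsFacet.exists_inequality {d : ℕ} (hd : 1 ≤ d) {P : Set (Fin d → ℝ)} {ι : Type*}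
    [Fintype ι] [Nonempty ι] {g : ι → ((Fin d → ℝ) × ℝ →ₗ[ℝ] ℝ)}
    (hP : ∀ x, x ∈ P ↔ ∀ i, 0 ≤ g i (homog x)) (hdim : polyDim P = d) {F : Set (Fin d → ℝ)}
    (hF : IsFacet P F) : ∃ i, F = {x ∈ P | g i (homog x) = 0} := by
  obtain ⟨x0, hx0⟩ := hF.nonempty (by omega)
  obtain ⟨y, hy, hFy⟩ := hF.1.exists_functional ⟨x0, hx0⟩
  have hcomb : ∀ (a b : Fin d → ℝ) (u v : ℝ), u + v = 1 →
      homog (u • a + v • b) = u • homog a + v • homog b := by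
    intro a b u v huv
    simp [homog, huv]
  have hsP := polyDim_eq_finrank P
  have hsF := polyDim_eq_finrank F
  have hFd := hF.2
  have hPtop : Submodule.span ℝ (homog '' P) = ⊤ := by
    apply Submodule.eq_top_of_finrank_eq
    simp
    omega
  obtain ⟨p, hp, hyp⟩ : ∃ p ∈ P, 0 < y (homog p) := by
    by_contra h
    push Not at h
    have : F = P := by
      rw [hFy]
      ext x
      exact ⟨fun h => h.1, fun hx => ⟨hx, le_antisymm (h x hx) (hy x hx)⟩⟩
    rw [this] at hFd
    omega
  have hker : ∀ z : (Fin d → ℝ) × ℝ →ₗ[ℝ] ℝ, z ≠ 0 → (∀ x ∈ F, z (homog x) = 0) →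
      LinearMap.ker z = Submodule.span ℝ (homog '' F) := by
    intro z hz hzF
    symm
    apply Submodule.eq_of_le_of_finrank_le
    · rw [Submodule.span_le]
      rintro _ ⟨x, hx, rfl⟩
      exact hzF x hx
    · obtain ⟨v, hv⟩ := (show ∃ v, z v ≠ 0 by
        by_contra h
        push Not at h
        exact hz (LinearMap.ext h))
      have := finrank_inf_ker_add_one ⊤ z (v := v) trivial hv
      rw [top_inf_eq, finrank_top] at this
      simp at this
      omega
  have hyF : ∀ x ∈ F, y (homog x) = 0 := by
    intro x hx
    rw [hFy] at hx
    exact hx.2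
  have hFP : F ⊆ P := by
    rw [hFy]
    exact fun x hx => hx.1
  suffices h : ∃ i, g i ≠ 0 ∧ ∀ x ∈ F, g i (homog x) = 0 by
    obtain ⟨i, hi, hiF⟩ := h
    refine ⟨i, ?_⟩
    have e : LinearMap.ker (g i) = LinearMap.ker y := by
      rw [hker _ hi hiF, hker y _ hyF]
      rintro rfl
      simp at hyp
    rw [hFy]
    ext x
    refine and_congr_right fun _ => ?_
    rw [← LinearMap.mem_ker, ← LinearMap.mem_ker, e]
  by_contra hcon
  push Not at hcon
  -- Averaging such points gives a point of F at which all nonzero inequalities are strict. P then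
  -- extends beyond it away from p, where y becomes negative.
  have hpt : ∀ i, ∃ x ∈ F, g i ≠ 0 → 0 < g i (homog x) := by
    intro i
    by_cases hi : g i = 0
    · exact ⟨x0, hx0, fun h => absurd hi h⟩
    · obtain ⟨x, hx, hne⟩ := hcon i hi
      exact ⟨x, hx, fun _ => lt_of_le_of_ne ((hP x).1 (hFP hx) i) (Ne.symm hne)⟩
  choose z hzF hz using hpt
  have hc : 0 < (Fintype.card ι : ℝ)⁻¹ := inv_pos.2 (by exact_mod_cast Fintype.card_pos)
  set w : ι → ℝ := fun _ => (Fintype.card ι : ℝ)⁻¹ with hw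
  have hw1 : ∑ i, w i = 1 := by simp [hw]
  set c : Fin d → ℝ := ∑ i, w i • z i with hcdef
  have hgc : ∀ y : (Fin d → ℝ) × ℝ →ₗ[ℝ] ℝ,
      y (homog c) = ∑ i, (Fintype.card ι : ℝ)⁻¹ * y (homog (z i)) := by
    intro y
    rw [hcdef, homog_sum hw1, map_sum]
    simp [hw]
  have hyc : y (homog c) = 0 := by
    rw [hgc]
    exact Finset.sum_eq_zero fun i _ => by rw [hyF _ (hzF i), mul_zero]
  have hcpos : ∀ i, g i ≠ 0 → 0 < g i (homog c) := by
    intro i hi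
    rw [hgc]
    refine Finset.sum_pos' (fun j _ => mul_nonneg hc.le ((hP _).1 (hFP (hzF j)) i))
      ⟨i, Finset.mem_univ i, mul_pos hc (hz i hi)⟩
  have hev : ∀ᶠ ε : ℝ in nhdsWithin 0 (Ioi 0), ∀ i,
      0 ≤ g i (homog ((1 + ε) • c + (-ε) • p)) := by
    rw [Filter.eventually_all]
    intro i
    by_cases hi : g i = 0
    · simp [hi]
    · have hcont : Filter.Tendsto (fun ε : ℝ => (1 + ε) * g i (homog c) + (-ε) * g i (homog p))
          (nhds 0) (nhds ((1 + 0) * g i (homog c) + (-0) * g i (homog p))) := by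
        apply Continuous.tendsto'
        · fun_prop
        · rfl
      have h2 : 0 < (1 + 0) * g i (homog c) + (-0) * g i (homog p) := by
        simpa using hcpos i hi
      have h3 := hcont.eventually (lt_mem_nhds h2)
      filter_upwards [nhdsWithin_le_nhds h3] with ε hε
      rw [hcomb _ _ _ _ (by ring), map_add, map_smul, map_smul]
      exact hε.le
  obtain ⟨ε, hε, hε0⟩ := (hev.and self_mem_nhdsWithin).exists
  have h1 := hy _ ((hP _).2 hε)
  rw [hcomb _ _ _ _ (by ring), map_add, map_smul, map_smul, hyc] at h1
  have h2 : 0 < ε * y (homog p) := mul_pos hε0 hyp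
  simp at h1
  linarith

theorem numFacets_le_card {d : ℕ} (hd : 1 ≤ d) {P : Set (Fin d → ℝ)} {ι : Type*}
    [Fintype ι] [Nonempty ι] {g : ι → ((Fin d → ℝ) × ℝ →ₗ[ℝ] ℝ)}
    (hP : ∀ x, x ∈ P ↔ ∀ i, 0 ≤ g i (homog x)) (hdim : polyDim P = d) :
    numFacets P ≤ Fintype.card ι := by
  choose φ hφ using fun F : {F : Set (Fin d → ℝ) | IsFacet P F} =>
    IsFacet.exists_inequality hd hP hdim F.2
  have hinj : Function.Injective φ := by
    intro F G h
    ext1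
    rw [hφ F, hφ G, h]
  have := Nat.card_le_card_of_injective φ hinj
  rwa [Nat.card_eq_fintype_card (α := ι)] at this

namespace ConeExtension

variable {d : ℕ} {P : Set (Fin d → ℝ)} {κ V : Type*} [AddCommGroup V] [Module ℝ V]
  (X : ConeExtension P κ V)

theorem injective : Function.Injective X.Y := by
  rw [injective_iff_map_eq_zero]
  intro v hv
  by_contra h
  have h1 := X.pos v hv.ge h
  have h2 := X.pos (-v) (by simp [hv]) (by simpa using h)
  rw [map_neg] at h2
  linarith

theorem le_finrank [FiniteDimensional ℝ V] (X : ConeExtension P κ V) : d + 1 ≤ finrank ℝ V := by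
  simpa using LinearMap.finrank_le_finrank_of_surjective X.surj

theorem exists_section : ∃ σ : (Fin d → ℝ) × ℝ →ₗ[ℝ] V, ∀ z, X.π (σ z) = z.1 ∧ X.τ (σ z) = z.2 := by
  obtain ⟨σ, hσ⟩ := (X.π.prod X.τ).exists_rightInverse_of_surjective
    (LinearMap.range_eq_top.2 X.surj)
  refine ⟨σ, fun z => ?_⟩
  have := LinearMap.congr_fun hσ z
  exact ⟨congrArg Prod.fst this, congrArg Prod.snd this⟩

/-- With no kernel, the lift of a point is unique, so the inequalities of the cone are inequalities
for P. -/
theorem numFacets_le_of_injective [Fintype κ] [Nonempty κ] (hd : 1 ≤ d) (hdim : polyDim P = d)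
    (hinj : Function.Injective (X.π.prod X.τ)) : numFacets P ≤ Fintype.card κ := by
  obtain ⟨σ, hσ⟩ := X.exists_section
  refine numFacets_le_card (g := fun i => (LinearMap.proj i).comp (X.Y.comp σ)) hd (fun x => ?_) hdim
  rw [X.proj]
  constructor
  · rintro ⟨v, hv, hv1, rfl⟩ i
    have : σ (homog (X.π v)) = v := by
      apply hinj
      ext1
      · exact (hσ _).1
      · exact (hσ _).2.trans hv1.symm
    simpa [this] using hv i
  · intro h
    exact ⟨σ (homog x), h, (hσ _).2, (hσ _).1⟩

theorem exists_ker_generator [FiniteDimensional ℝ V] (hV : finrank ℝ V = d + 2) :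
    ∃ l : V, l ≠ 0 ∧ X.π l = 0 ∧ X.τ l = 0 ∧
      ∀ v, X.π v = 0 → X.τ v = 0 → ∃ c : ℝ, v = c • l := by
  have h := LinearMap.finrank_range_add_finrank_ker (X.π.prod X.τ)
  rw [LinearMap.range_eq_top.2 X.surj, finrank_top] at h
  simp only [finrank_prod, finrank_fin_fun, finrank_self] at h
  obtain ⟨l, hl0, hl⟩ := (finrank_eq_one_iff' (K := ℝ)
    (V := LinearMap.ker (X.π.prod X.τ))).1 (by omega)
  have hl' : X.π l = 0 ∧ X.τ l = 0 := by
    have := l.2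
    rw [LinearMap.mem_ker] at this
    exact ⟨congrArg Prod.fst this, congrArg Prod.snd this⟩
  refine ⟨l, by simpa using hl0, hl'.1, hl'.2, fun v h1 h2 => ?_⟩
  obtain ⟨c, hc⟩ := hl ⟨v, by
    rw [LinearMap.mem_ker]
    ext1
    · exact h1
    · exact h2⟩
  exact ⟨c, by simpa using (congrArg Subtype.val hc).symm⟩

theorem exists_pos {l : V} (hl : l ≠ 0) (hτ : X.τ l = 0) : ∃ i, 0 < X.Y l i := by
  by_contra h
  push Not at h
  have := X.pos (-l) (fun i => by simpa using h i) (by simpa using hl)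
  simp [hτ] at this

theorem exists_neg {l : V} (hl : l ≠ 0) (hτ : X.τ l = 0) : ∃ i, X.Y l i < 0 := by
  obtain ⟨i, hi⟩ := X.exists_pos (neg_ne_zero.2 hl) (by simpa using hτ)
  exact ⟨i, by simpa using hi⟩

open Classical in
/-- Fourier-Motzkin elimination of the kernel of the projection. -/
theorem numFacets_le_fourierMotzkin [Fintype κ] (hd : 1 ≤ d) (hdim : polyDim P = d) {l : V}
    (hl0 : l ≠ 0) (hπ : X.π l = 0) (hτ : X.τ l = 0)
    (hl : ∀ v, X.π v = 0 → X.τ v = 0 → ∃ c : ℝ, v = c • l) :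
    numFacets P ≤ Fintype.card {i // X.Y l i = 0} +
      Fintype.card {i // 0 < X.Y l i} * Fintype.card {i // X.Y l i < 0} := by
  obtain ⟨σ, hσ⟩ := X.exists_section
  obtain ⟨i1, hi1⟩ := X.exists_pos hl0 hτ
  obtain ⟨j1, hj1⟩ := X.exists_neg hl0 hτ
  rw [← Fintype.card_prod, ← Fintype.card_sum]
  have : Nonempty ({i // X.Y l i = 0} ⊕ {i // 0 < X.Y l i} × {i // X.Y l i < 0}) :=
    ⟨Sum.inr (⟨i1, hi1⟩, ⟨j1, hj1⟩)⟩
  let a : κ → ((Fin d → ℝ) × ℝ →ₗ[ℝ] ℝ) := fun i => (LinearMap.proj i).comp (X.Y.comp σ)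
  refine numFacets_le_card (g := Sum.elim (fun i => a i)
    (fun p => X.Y l p.1 • a p.2 - X.Y l p.2 • a p.1)) hd (fun x => ?_) hdim
  rw [X.proj]
  constructor
  · rintro ⟨v, hv, hv1, rfl⟩
    obtain ⟨c, hc⟩ := hl (v - σ (homog (X.π v))) (by simp [hσ, homog]) (by simp [hσ, hv1, homog])
    have hY : ∀ i, a i (homog (X.π v)) = X.Y v i - c * X.Y l i := by
      intro i
      have := congrFun (congrArg X.Y hc) i
      simp only [map_sub, map_smul, Pi.sub_apply, Pi.smul_apply, smul_eq_mul] at this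
      simp only [a, LinearMap.comp_apply, LinearMap.proj_apply]
      linarith
    rintro (⟨i, hi⟩ | ⟨⟨i, hi⟩, ⟨j, hj⟩⟩)
    · simp only [Sum.elim_inl, hY, hi]
      simpa using hv i
    · simp only [Sum.elim_inr, LinearMap.sub_apply, LinearMap.smul_apply, hY, smul_eq_mul]
      have h1 := mul_nonneg hi.le (hv j)
      have h2 := mul_nonneg (neg_nonneg.2 hj.le) (hv i)
      nlinarith
  · intro h
    have : Nonempty {i // 0 < X.Y l i} := ⟨⟨i1, hi1⟩⟩
    obtain ⟨⟨i0, hi0⟩, hmax⟩ := Finite.exists_max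
      (fun i : {i // 0 < X.Y l i} => - a i (homog x) / X.Y l i)
    -- The largest lower bound on the multiple of l; the pair inequalities say that it respects
    -- every upper bound.
    set t := - a i0 (homog x) / X.Y l i0 with ht
    refine ⟨σ (homog x) + t • l, fun i => ?_, by simp [hσ, hτ, homog], by simp [hσ, hπ, homog]⟩
    have e : X.Y (σ (homog x) + t • l) i = a i (homog x) + t * X.Y l i := by
      simp [a]
    rw [e, Pi.zero_apply]
    rcases lt_trichotomy (X.Y l i) 0 with hi | hi | hi
    · have h1 := h (Sum.inr (⟨i0, hi0⟩, ⟨i, hi⟩))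
      simp only [Sum.elim_inr, LinearMap.sub_apply, LinearMap.smul_apply, smul_eq_mul] at h1
      have h2 : a i (homog x) + t * X.Y l i =
          (X.Y l i0 * a i (homog x) - X.Y l i * a i0 (homog x)) / X.Y l i0 := by
        rw [ht]
        field_simp
        ring
      rw [h2]
      exact div_nonneg h1 hi0.le
    · have h1 := h (Sum.inl ⟨i, hi⟩)
      simpa [hi] using h1
    · have h1 := hmax ⟨i, hi⟩
      rw [div_le_iff₀ hi] at h1
      linarith

/-- A vertex of `P` that lifts to a point of the cone lifts to every ray below that point. -/
theorem proj_of_le {p : Fin d → ℝ} (hp : p ∈ P.extremePoints ℝ) {v w : V} (hv : X.τ v = 1)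
    (hvp : X.π v = p) (hw : 0 ≤ X.Y w) (hwv : X.Y w ≤ X.Y v) : X.π w = X.τ w • p := by
  by_cases hw0 : w = 0
  · simp [hw0]
  by_cases hu0 : v - w = 0
  · rw [← sub_eq_zero.1 hu0, hv, one_smul, hvp]
  have hwpos := X.pos w hw hw0
  have hu : 0 ≤ X.Y (v - w) := by
    rw [map_sub]
    exact sub_nonneg.2 hwv
  have hupos := X.pos _ hu hu0
  have hmem : ∀ u : V, 0 ≤ X.Y u → 0 < X.τ u → (X.τ u)⁻¹ • X.π u ∈ P := by
    intro u h1 h2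
    refine (X.proj _).2 ⟨(X.τ u)⁻¹ • u, ?_, ?_, by simp⟩
    · rw [map_smul]
      exact smul_nonneg (inv_pos.2 h2).le h1
    · simp [h2.ne']
  -- The vertex p is a convex combination of the normalized projections of w and v - w, with weights
  -- τ w and τ (v - w).
  have := (mem_extremePoints_iff_left.1 hp).2 _ (hmem w hw hwpos) _ (hmem _ hu hupos)
    ⟨X.τ w, X.τ (v - w), hwpos, hupos, by simp [hv], by
      rw [smul_smul, smul_smul, mul_inv_cancel₀ hwpos.ne', mul_inv_cancel₀ hupos.ne', one_smul,
        one_smul, map_sub, hvp]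
      simp⟩
  rw [← this, smul_smul, mul_inv_cancel₀ hwpos.ne', one_smul]

end ConeExtension

/-! ### Extreme rays of a hyperplane section of the orthant. -/

section Rays

variable {κ : Type*}

/-- Indices for the extreme rays of the cone `{s ≥ 0 | ∑ i, a i * s i = 0}`. -/
abbrev RayIdx (a : κ → ℝ) : Type _ := {k // a k = 0} ⊕ {i // 0 < a i} × {j // a j < 0}

open Classical in
/-- The extreme rays of the cone `{s ≥ 0 | ∑ i, a i * s i = 0}`. -/
noncomputable def rayVec (a : κ → ℝ) : RayIdx a → κ → ℝ
  | Sum.inl k => Pi.single k.1 1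
  | Sum.inr p => Pi.single p.1.1 (-a p.2.1) + Pi.single p.2.1 (a p.1.1)

open Classical in
/-- The support of a ray. -/
noncomputable def raySupp (a : κ → ℝ) : RayIdx a → Finset κ
  | Sum.inl k => {k.1}
  | Sum.inr p => {p.1.1, p.2.1}

variable {a : κ → ℝ}

theorem rayVec_nonneg (t : RayIdx a) : 0 ≤ rayVec a t := by
  classical
  rcases t with k | ⟨⟨i, hi⟩, ⟨j, hj⟩⟩
  · exact Pi.single_nonneg.2 zero_le_one
  · exact add_nonneg (Pi.single_nonneg.2 (by linarith)) (Pi.single_nonneg.2 hi.le)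

theorem rayVec_ne_zero_iff (t : RayIdx a) (i : κ) : rayVec a t i ≠ 0 ↔ i ∈ raySupp a t := by
  classical
  rcases t with k | ⟨⟨i', hi⟩, ⟨j, hj⟩⟩
  · simp [rayVec, raySupp, Pi.single_apply]
  · have hij : i' ≠ j := by
      rintro rfl
      linarith
    simp only [rayVec, raySupp, Pi.add_apply, Pi.single_apply, Finset.mem_insert,
      Finset.mem_singleton]
    by_cases h1 : i = i'
    · subst h1
      simp [hij, hj.ne]
    · by_cases h2 : i = j
      · subst h2
        simp [h1, hi.ne']
      · simp [h1, h2]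

theorem raySupp_nonempty (t : RayIdx a) : (raySupp a t).Nonempty := by
  rcases t with k | ⟨⟨i', hi⟩, ⟨j, hj⟩⟩ <;> simp [raySupp]

theorem rayVec_ne_zero (t : RayIdx a) : rayVec a t ≠ 0 := by
  intro h
  obtain ⟨i, hi⟩ := raySupp_nonempty t
  exact (rayVec_ne_zero_iff t i).2 hi (congrFun h i)

theorem card_raySupp_le (t : RayIdx a) : (raySupp a t).card ≤ 2 := by
  rcases t with k | ⟨⟨i', hi⟩, ⟨j, hj⟩⟩
  · simp [raySupp]
  · classical
    exact Finset.card_le_two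

theorem raySupp_injective : Function.Injective (raySupp a) := by
  have key : ∀ t t' : RayIdx a, raySupp a t = raySupp a t' →
      ∀ k : {k // a k = 0}, t = Sum.inl k → t' = Sum.inl k := by
    rintro t t' h k rfl
    have hk : k.1 ∈ raySupp a t' := by
      rw [← h]
      simp [raySupp]
    rcases t' with k' | ⟨⟨i', hi⟩, ⟨j, hj⟩⟩
    · have : k.1 = k'.1 := by simpa [raySupp] using hk
      rw [Subtype.ext this]
    · have hk2 := k.2
      have : k.1 = i' ∨ k.1 = j := by simpa [raySupp] using hk
      rcases this with h | h <;> rw [h] at hk2 <;> linarith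
  intro t t' h
  rcases t with k | ⟨⟨i, hi⟩, ⟨j, hj⟩⟩
  · exact (key _ _ h k rfl).symm
  rcases t' with k' | ⟨⟨i', hi'⟩, ⟨j', hj'⟩⟩
  · exact key _ _ h.symm k' rfl
  have h1 : i = i' := by
    have : i ∈ raySupp a (Sum.inr (⟨i', hi'⟩, ⟨j', hj'⟩)) := by
      rw [← h]
      simp [raySupp]
    have : i = i' ∨ i = j' := by simpa [raySupp] using this
    rcases this with h | rfl
    · exact h
    · linarith
  have h2 : j = j' := by
    have : j ∈ raySupp a (Sum.inr (⟨i', hi'⟩, ⟨j', hj'⟩)) := by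
      rw [← h]
      simp [raySupp]
    have : j = i' ∨ j = j' := by simpa [raySupp] using this
    rcases this with rfl | h
    · linarith
    · exact h
  subst h1 h2
  rfl

variable [Fintype κ]

theorem sum_mul_rayVec (t : RayIdx a) : ∑ i, a i * rayVec a t i = 0 := by
  classical
  rcases t with ⟨k, hk⟩ | ⟨⟨i, hi⟩, ⟨j, hj⟩⟩
  · simp [rayVec, Pi.single_apply, hk]
  · simp [rayVec, Pi.single_apply, mul_add, Finset.sum_add_distrib]
    ring

/-- On a support of one or two indices the hyperplane leaves one degree of freedom. This is the
extremality of the ray. -/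
theorem eq_smul_rayVec {s : κ → ℝ} (hs : ∑ i, a i * s i = 0) {t : RayIdx a}
    (ht : ∀ i, s i ≠ 0 → i ∈ raySupp a t) : ∃ c : ℝ, s = c • rayVec a t := by
  classical
  rcases t with ⟨k, hk⟩ | ⟨⟨i, hi⟩, ⟨j, hj⟩⟩
  · refine ⟨s k, funext fun i => ?_⟩
    by_cases h : i = k
    · simp [rayVec, h]
    · have : s i = 0 := by
        by_contra h0
        exact h (by simpa [raySupp] using ht i h0)
      simp [rayVec, h, this]
  · have hij : i ≠ j := by
      rintro rfl
      linarith
    have h0 : ∀ k, k ≠ i → k ≠ j → s k = 0 := by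
      intro k h1 h2
      by_contra h0
      have := ht k h0
      simp [raySupp, h1, h2] at this
    have hsum : a i * s i + a j * s j = 0 := by
      rw [← Finset.sum_pair (f := fun k => a k * s k) hij, ← hs]
      apply Finset.sum_subset (Finset.subset_univ _)
      intro k _ hk
      simp only [Finset.mem_insert, Finset.mem_singleton, not_or] at hk
      rw [h0 k hk.1 hk.2, mul_zero]
    refine ⟨s j / a i, funext fun k => ?_⟩
    simp only [rayVec, Pi.smul_apply, Pi.add_apply, smul_eq_mul, Pi.single_apply]
    by_cases h1 : k = i
    · subst h1
      simp only [if_true, if_neg hij, add_zero]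
      field_simp
      linarith
    · by_cases h2 : k = j
      · subst h2
        simp only [if_true, if_neg h1, zero_add]
        field_simp
      · simp [h1, h2, h0 k h1 h2]

/-- Every nonzero point of the cone lies above a positive multiple of some ray. -/
theorem exists_smul_rayVec_le {s : κ → ℝ} (hs0 : 0 ≤ s) (hne : s ≠ 0)
    (hs : ∑ i, a i * s i = 0) : ∃ (t : RayIdx a) (ε : ℝ), 0 < ε ∧ ε • rayVec a t ≤ s := by
  -- The smallest ratio of coordinates over the support then serves as ε.
  suffices h : ∃ t : RayIdx a, ∀ i ∈ raySupp a t, 0 < s i by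
    obtain ⟨t, ht⟩ := h
    obtain ⟨i0, hi0, hmin⟩ := (raySupp a t).exists_min_image (fun i => s i / rayVec a t i)
      (raySupp_nonempty t)
    have hpos : ∀ i ∈ raySupp a t, 0 < rayVec a t i := fun i hi =>
      lt_of_le_of_ne (rayVec_nonneg t i) (Ne.symm ((rayVec_ne_zero_iff t i).2 hi))
    refine ⟨t, s i0 / rayVec a t i0, div_pos (ht _ hi0) (hpos _ hi0), fun i => ?_⟩
    by_cases hi : i ∈ raySupp a t
    · exact (le_div_iff₀ (hpos i hi)).1 (hmin i hi)
    · have : rayVec a t i = 0 := by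
        by_contra h
        exact hi ((rayVec_ne_zero_iff t i).1 h)
      simpa [this] using hs0 i
  by_cases hk : ∃ k, a k = 0 ∧ s k ≠ 0
  · obtain ⟨k, hk, hsk⟩ := hk
    refine ⟨Sum.inl ⟨k, hk⟩, fun i hi => ?_⟩
    have : i = k := by simpa [raySupp] using hi
    rw [this]
    exact lt_of_le_of_ne (hs0 k) hsk.symm
  push Not at hk
  obtain ⟨k, hsk⟩ : ∃ k, s k ≠ 0 := by
    by_contra h
    push Not at h
    exact hne (funext h)
  have hak : a k * s k ≠ 0 := mul_ne_zero (fun h => hsk (hk k h)) hsk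
  obtain ⟨i, -, hi⟩ := Finset.exists_pos_of_sum_zero_of_exists_nonzero _ hs ⟨k, Finset.mem_univ k, hak⟩
  obtain ⟨j, -, hj⟩ := Finset.exists_pos_of_sum_zero_of_exists_nonzero (fun i => -(a i * s i))
    (by rw [Finset.sum_neg_distrib, hs, neg_zero]) ⟨k, Finset.mem_univ k, neg_ne_zero.2 hak⟩
  have hsi := hs0 i
  have hsj := hs0 j
  simp only [Pi.zero_apply] at hsi hsj
  have hai : 0 < a i := by
    by_contra h
    nlinarith
  have haj : a j < 0 := by
    by_contra h
    nlinarith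
  refine ⟨Sum.inr (⟨i, hai⟩, ⟨j, haj⟩), fun k hk => ?_⟩
  have hk' : k = i ∨ k = j := by simpa [raySupp] using hk
  rcases hk' with rfl | rfl
  · exact lt_of_le_of_ne hsi (by rintro h; rw [← h] at hi; simp at hi)
  · exact lt_of_le_of_ne hsj (by rintro h; rw [← h] at hj; simp at hj)

end Rays

/-! ### Rays over vertices of P and unused rays. -/

namespace ConeExtension

variable {d : ℕ} {P : Set (Fin d → ℝ)} {κ V : Type*} [AddCommGroup V] [Module ℝ V]
  [Fintype κ] (X : ConeExtension P κ V)

theorem finrank_le (X : ConeExtension P κ V) : finrank ℝ V ≤ Fintype.card κ := by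
  simpa using LinearMap.finrank_le_finrank_of_injective X.injective

/-- Here `X.Y` is bijective, so the cone is an orthant, and each vertex of P lifts to a coordinate
ray of its own. -/
theorem numVertices_le [FiniteDimensional ℝ V] (X : ConeExtension P κ V)
    (hV : finrank ℝ V = Fintype.card κ) : numVertices P ≤ Fintype.card κ := by
  classical
  have hsurj : Function.Surjective X.Y :=
    (LinearMap.injective_iff_surjective_of_finrank_eq_finrank (by simpa using hV)).1 X.injective
  have key : ∀ p : P.extremePoints ℝ, ∃ k : κ, ∃ w, X.Y w = Pi.single k 1 ∧ X.π w = X.τ w • p.1 := by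
    rintro ⟨p, hp⟩
    obtain ⟨v, hv, hv1, hvp⟩ := (X.proj p).1 hp.1
    obtain ⟨k, hk⟩ : ∃ k, X.Y v k ≠ 0 := by
      by_contra h
      push Not at h
      have : v = 0 := X.injective (by rw [map_zero]; exact funext h)
      simp [this] at hv1
    have hkpos : 0 < X.Y v k := lt_of_le_of_ne (hv k) hk.symm
    obtain ⟨w, hw⟩ := hsurj (Pi.single k 1)
    have h := X.proj_of_le hp hv1 hvp (w := X.Y v k • w)
      (by
        rw [map_smul, hw]
        exact smul_nonneg hkpos.le (Pi.single_nonneg.2 zero_le_one))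
      (by
        rw [map_smul, hw]
        intro i
        by_cases hi : i = k
        · simp [hi]
        · simpa [hi] using hv i)
    refine ⟨k, w, hw, ?_⟩
    rw [map_smul, map_smul, smul_eq_mul, mul_smul] at h
    exact smul_right_injective _ hkpos.ne' h
  choose k w hw hwp using key
  have hinj : Function.Injective k := by
    intro p p' h
    have e : w p = w p' := X.injective (by rw [hw, hw, h])
    have hpos : 0 < X.τ (w p) := X.pos _ (by rw [hw]; exact Pi.single_nonneg.2 zero_le_one) (by
      intro h0
      have := hw p
      rw [h0, map_zero] at this
      exact one_ne_zero (Pi.single_eq_zero_iff.1 this.symm))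
    have h1 := hwp p
    rw [e, hwp p', ← e] at h1
    exact Subtype.ext (smul_right_injective _ hpos.ne' h1).symm
  have := Nat.card_le_card_of_injective k hinj
  rwa [Nat.card_eq_fintype_card (α := κ)] at this

theorem exists_hyperplane (hV : finrank ℝ V + 1 = Fintype.card κ) :
    ∃ a : κ → ℝ, ∀ s : κ → ℝ, (∃ v, X.Y v = s) ↔ ∑ i, a i * s i = 0 := by
  classical
  have hr : finrank ℝ (LinearMap.range X.Y) = finrank ℝ V :=
    LinearMap.finrank_range_of_inj X.injective
  have hlt : LinearMap.range X.Y < ⊤ := by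
    rw [lt_top_iff_ne_top]
    intro h
    rw [h, finrank_top] at hr
    simp at hr
    omega
  obtain ⟨f, hf, hle⟩ := Submodule.exists_le_ker_of_lt_top _ hlt
  have heq : LinearMap.range X.Y = LinearMap.ker f := by
    apply Submodule.eq_of_le_of_finrank_le hle
    obtain ⟨v, hv⟩ : ∃ v, f v ≠ 0 := by
      by_contra h
      push Not at h
      exact hf (LinearMap.ext h)
    have := finrank_inf_ker_add_one ⊤ f (v := v) trivial hv
    rw [top_inf_eq, finrank_top] at this
    simp at this
    omega
  refine ⟨fun i => f (fun j => if i = j then 1 else 0), fun s => ?_⟩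
  rw [← LinearMap.mem_range, heq, LinearMap.mem_ker, LinearMap.pi_apply_eq_sum_univ f s]
  simp [mul_comm]

variable {a : κ → ℝ} (ha : ∀ s : κ → ℝ, (∃ v, X.Y v = s) ↔ ∑ i, a i * s i = 0)

/-- A lift to `V` of an extreme ray. -/
noncomputable def ray (t : RayIdx a) : V := ((ha _).2 (sum_mul_rayVec t)).choose

theorem Y_ray (t : RayIdx a) : X.Y (X.ray ha t) = rayVec a t :=
  ((ha _).2 (sum_mul_rayVec t)).choose_spec

theorem τ_ray_pos (t : RayIdx a) : 0 < X.τ (X.ray ha t) := by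
  apply X.pos
  · rw [Y_ray]
    exact rayVec_nonneg t
  · intro h
    apply rayVec_ne_zero t
    rw [← X.Y_ray ha, h, map_zero]

/-- Any lift of p dominates a positive multiple of some ray, and `proj_of_le` forces that ray to lie
over p. -/
theorem exists_ray_of_extreme {p : Fin d → ℝ} (hp : p ∈ P.extremePoints ℝ) :
    ∃ t : RayIdx a, X.π (X.ray ha t) = X.τ (X.ray ha t) • p := by
  obtain ⟨v, hv, hv1, hvp⟩ := (X.proj p).1 hp.1
  have hv0 : X.Y v ≠ 0 := by
    intro h
    have : v = 0 := X.injective (by rw [map_zero, h])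
    simp [this] at hv1
  obtain ⟨t, ε, hε, hle⟩ := exists_smul_rayVec_le hv hv0 ((ha _).1 ⟨v, rfl⟩)
  have h := X.proj_of_le hp hv1 hvp (w := ε • X.ray ha t)
    (by
      rw [map_smul, Y_ray]
      exact smul_nonneg hε.le (rayVec_nonneg t))
    (by rwa [map_smul, Y_ray])
  refine ⟨t, ?_⟩
  rw [map_smul, map_smul, smul_eq_mul, mul_smul] at h
  exact smul_right_injective _ hε.ne' h

/-- The ray through which a vertex of `P` is lifted. -/
noncomputable def vertexRay (p : P.extremePoints ℝ) : RayIdx a :=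
  (X.exists_ray_of_extreme ha p.2).choose

theorem π_vertexRay (p : P.extremePoints ℝ) :
    X.π (X.ray ha (X.vertexRay ha p)) = X.τ (X.ray ha (X.vertexRay ha p)) • p.1 :=
  (X.exists_ray_of_extreme ha p.2).choose_spec

theorem vertexRay_injective : Function.Injective (X.vertexRay ha) := by
  intro p p' h
  have h1 := X.π_vertexRay ha p
  rw [h, X.π_vertexRay ha p'] at h1
  exact Subtype.ext (smul_right_injective _ (X.τ_ray_pos ha _).ne' h1).symm

/-- Off the support of the ray the left side has coordinate -w_i ≤ 0, so every positive coordinate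
of c • l sits on the support. The sign of c decides which alternative holds. -/
theorem subset_raySupp {l w : V} {t : RayIdx a} {s c : ℝ} (hw : 0 ≤ X.Y w)
    (h : s • X.ray ha t - w = c • l) (hc : c ≠ 0) :
    (∀ i, 0 < X.Y l i → i ∈ raySupp a t) ∨ (∀ i, X.Y l i < 0 → i ∈ raySupp a t) := by
  have hY : ∀ i, s * rayVec a t i - X.Y w i = c * X.Y l i := by
    intro i
    have := congrFun (congrArg X.Y h) i
    simpa [Y_ray] using this
  have key : ∀ i, 0 < c * X.Y l i → i ∈ raySupp a t := by
    intro i hi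
    rw [← rayVec_ne_zero_iff]
    intro h0
    have h1 := hY i
    have h2 := hw i
    rw [h0] at h1
    simp only [Pi.zero_apply] at h2
    linarith
  rcases lt_or_gt_of_ne hc with h | h
  · exact Or.inr fun i hi => key i (mul_pos_of_neg_of_neg h hi)
  · exact Or.inl fun i hi => key i (mul_pos h hi)

/-- A ray that lifts no vertex of `P` supports one sign of the kernel of the projection. -/
theorem subset_raySupp_of_notMem_range {l : V}
    (hl : ∀ v, X.π v = 0 → X.τ v = 0 → ∃ c : ℝ, v = c • l) {t : RayIdx a}
    (ht : t ∉ range (X.vertexRay ha)) :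
    (∀ i, 0 < X.Y l i → i ∈ raySupp a t) ∨ (∀ i, X.Y l i < 0 → i ∈ raySupp a t) := by
  have hτ := X.τ_ray_pos ha t
  set r := X.ray ha t with hr
  have hYr : 0 ≤ X.Y r := by
    rw [hr, Y_ray]
    exact rayVec_nonneg t
  set x : Fin d → ℝ := (X.τ r)⁻¹ • X.π r with hx
  have hxP : x ∈ P := (X.proj x).2 ⟨(X.τ r)⁻¹ • r, by
    rw [map_smul]
    exact smul_nonneg (inv_pos.2 hτ).le hYr, by simp [hτ.ne'], by simp [hx]⟩
  -- Over a vertex, the ray is compared with the chosen one; otherwise with a lift of a proper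
  -- convex combination of x. In either case c = 0 would make two different things proportional.
  by_cases hxv : x ∈ P.extremePoints ℝ
  · set t' := X.vertexRay ha ⟨x, hxv⟩ with ht'
    have hτ' := X.τ_ray_pos ha t'
    have hπ' : X.π (X.ray ha t') = X.τ (X.ray ha t') • x := X.π_vertexRay ha ⟨x, hxv⟩
    set r' := X.ray ha t' with hr'
    obtain ⟨c, hc⟩ := hl ((X.τ r)⁻¹ • r - (X.τ r')⁻¹ • r')
      (by simp [hπ', smul_smul, hτ'.ne', hx]) (by simp [hτ.ne', hτ'.ne'])
    refine X.subset_raySupp ha ?_ hc ?_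
    · rw [map_smul, hr', Y_ray]
      exact smul_nonneg (inv_pos.2 hτ').le (rayVec_nonneg t')
    · rintro rfl
      rw [zero_smul, sub_eq_zero] at hc
      apply ht
      refine ⟨⟨x, hxv⟩, ?_⟩
      apply raySupp_injective
      ext i
      rw [← rayVec_ne_zero_iff, ← rayVec_ne_zero_iff, ← X.Y_ray ha, ← X.Y_ray ha]
      have := congrFun (congrArg X.Y hc) i
      rw [map_smul, map_smul, Pi.smul_apply, Pi.smul_apply, smul_eq_mul, smul_eq_mul] at this
      rw [← ht', ← hr', ← hr]
      constructor
      · intro h h0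
        rw [h0, mul_zero, eq_comm, mul_eq_zero] at this
        exact this.elim (inv_pos.2 hτ').ne' h
      · intro h h0
        rw [h0, mul_zero, mul_eq_zero] at this
        exact this.elim (inv_pos.2 hτ).ne' h
  · rw [mem_extremePoints_iff_left] at hxv
    push Not at hxv
    obtain ⟨x1, hx1, x2, hx2, ⟨u, v, hu, hv, huv, huvx⟩, hne⟩ := hxv hxP
    obtain ⟨v1, h1, h1', h1''⟩ := (X.proj x1).1 hx1
    obtain ⟨v2, h2, h2', h2''⟩ := (X.proj x2).1 hx2
    obtain ⟨c, hc⟩ := hl ((X.τ r)⁻¹ • r - (u • v1 + v • v2))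
      (by simp [h1'', h2'', huvx, hx]) (by simp [h1', h2', huv, hτ.ne'])
    refine X.subset_raySupp ha ?_ hc ?_
    · rw [map_add, map_smul, map_smul]
      exact add_nonneg (smul_nonneg hu.le h1) (smul_nonneg hv.le h2)
    · rintro rfl
      rw [zero_smul, sub_eq_zero] at hc
      apply hne
      obtain ⟨c1, hc1⟩ := eq_smul_rayVec (t := t) ((ha _).1 ⟨v1, rfl⟩) (fun i hi => by
        rw [← rayVec_ne_zero_iff, ← X.Y_ray ha, ← hr]
        intro h0
        have := congrFun (congrArg X.Y hc) i
        simp only [map_add, map_smul, Pi.add_apply, Pi.smul_apply, smul_eq_mul, h0, mul_zero]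
          at this
        have h1i := h1 i
        have h2i := mul_nonneg hv.le (h2 i)
        have := mul_pos hu (lt_of_le_of_ne h1i (Ne.symm hi))
        linarith)
      have e : v1 = c1 • r := X.injective (by rw [hc1, map_smul, hr, Y_ray])
      have hc1' : c1 = (X.τ r)⁻¹ := by
        have := congrArg X.τ e
        rw [h1', map_smul, smul_eq_mul] at this
        exact eq_inv_of_mul_eq_one_left this.symm
      rw [← h1'', e, hc1', map_smul]

end ConeExtension

/-! ### Counting rays and recognizing the prism. -/

open Classical in
theorem card_sign_partition {κ : Type*} [Fintype κ] (b : κ → ℝ) :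
    Fintype.card {i // b i = 0} + Fintype.card {i // 0 < b i} + Fintype.card {i // b i < 0} =
      Fintype.card κ := by
  simp only [Fintype.card_subtype]
  rw [← Finset.card_union_of_disjoint, ← Finset.card_union_of_disjoint, ← Finset.card_univ]
  · congr 1
    ext i
    rcases lt_trichotomy (b i) 0 with h | h | h <;> simp [h]
  · rw [Finset.disjoint_left]
    intro i
    simp only [Finset.mem_union, Finset.mem_filter, Finset.mem_univ, true_and, not_lt]
    rintro (h | h) <;> linarith
  · rw [Finset.disjoint_left]
    intro i
    simp only [Finset.mem_filter, Finset.mem_univ, true_and, not_lt]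
    intro h
    linarith

/-- The values of an affine functional on the vertices of an iterated pyramid over a prism. -/
def prismVal {n : ℕ} (s : Fin 2 → ℝ) (t : Fin 3 → ℝ) (u : Fin n → ℝ) :
    (Fin 2 × Fin 3) ⊕ Fin n → ℝ :=
  Sum.elim (fun p => s p.1 + t p.2) u

namespace ConeExtension

variable {d : ℕ} {P : Set (Fin d → ℝ)} {κ V : Type*} [AddCommGroup V] [Module ℝ V]
  [Fintype κ] (X : ConeExtension P κ V)
  {a : κ → ℝ} (ha : ∀ s : κ → ℝ, (∃ v, X.Y v = s) ↔ ∑ i, a i * s i = 0)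

open Classical in
/-- If `P` has many facets then at most one ray lifts no vertex of `P`. -/
theorem notMem_range_vertexRay (hd : 1 ≤ d) (hdim : polyDim P = d)
    (hfacet : d + 4 ≤ numFacets P) (hκ : Fintype.card κ = d + 3) {l : V} (hl0 : l ≠ 0)
    (hπ : X.π l = 0) (hτ : X.τ l = 0) (hl : ∀ v, X.π v = 0 → X.τ v = 0 → ∃ c : ℝ, v = c • l) :
    (∀ t t', t ∉ range (X.vertexRay ha) → t' ∉ range (X.vertexRay ha) → t = t') ∧
    ∀ t, t ∉ range (X.vertexRay ha) → ∃ p, t = Sum.inr p := by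
  have h1 := hfacet.trans (X.numFacets_le_fourierMotzkin hd hdim hl0 hπ hτ hl)
  have h2 := card_sign_partition (X.Y l)
  simp only [Fintype.card_subtype] at h1 h2
  set p := Finset.univ.filter (fun i => 0 < X.Y l i) with hp
  set q := Finset.univ.filter (fun i => X.Y l i < 0) with hq
  -- Substitutes z + p + q = d + 3 into d + 4 ≤ z + pq, where z counts the zero coordinates of Y l.
  have h3 : p.card + q.card + 1 ≤ p.card * q.card := by omega
  have hp2 : 2 ≤ p.card := by
    by_contra h
    interval_cases p.card <;> omega
  have hq2 : 2 ≤ q.card := by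
    by_contra h
    interval_cases q.card <;> omega
  have hnot : ¬ (p.card = 2 ∧ q.card = 2) := by
    rintro ⟨h, h'⟩
    rw [h, h'] at h3
    omega
  have hsub : ∀ t, t ∉ range (X.vertexRay ha) → raySupp a t = p ∨ raySupp a t = q := by
    intro t ht
    rcases X.subset_raySupp_of_notMem_range ha hl ht with h | h
    · left
      refine (Finset.eq_of_subset_of_card_le (fun i hi => h i ?_)
        ((card_raySupp_le t).trans hp2)).symm
      simpa [hp] using hi
    · right
      refine (Finset.eq_of_subset_of_card_le (fun i hi => h i ?_)
        ((card_raySupp_le t).trans hq2)).symm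
      simpa [hq] using hi
  constructor
  · intro t t' ht ht'
    apply raySupp_injective
    have c := card_raySupp_le t
    have c' := card_raySupp_le t'
    rcases hsub t ht with h | h <;> rcases hsub t' ht' with h' | h' <;> rw [h] at c ⊢ <;>
      rw [h'] at c' ⊢ <;> exact absurd ⟨by omega, by omega⟩ hnot
  · intro t ht
    rcases t with k | pr
    · have c : (raySupp a (Sum.inl k)).card = 1 := by simp [raySupp]
      rcases hsub _ ht with h | h <;> rw [h] at c <;> omega
    · exact ⟨pr, rfl⟩

open Classical in
/-- The coordinates provide functionals with prescribed values on the rays. -/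
theorem exists_functional_on_rays (mz : {i // a i = 0} → ℝ) (mp : {i // 0 < a i} → ℝ)
    (mn : {i // a i < 0} → ℝ) : ∃ φ : V →ₗ[ℝ] ℝ,
      (∀ k, φ (X.ray ha (Sum.inl k)) = mz k) ∧
      ∀ i j, φ (X.ray ha (Sum.inr (i, j))) = (-a j * a i) * (mp i + mn j) := by
  -- The factors a_i and -a_j cancel the asymmetry of the ray vector -a_j e_i + a_i e_j.
  let μ : κ → ℝ := fun i =>
    if h : 0 < a i then a i * mp ⟨i, h⟩
    else if h' : a i < 0 then -a i * mn ⟨i, h'⟩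
    else mz ⟨i, le_antisymm (not_lt.1 h) (not_lt.1 h')⟩
  refine ⟨(∑ i, μ i • (LinearMap.proj i : (κ → ℝ) →ₗ[ℝ] ℝ)).comp X.Y, ?_, ?_⟩
  · rintro ⟨k, hk⟩
    have e1 : μ k = mz ⟨k, hk⟩ := by simp [μ, hk]
    simp [Y_ray, rayVec, Pi.single_apply, e1]
  · rintro ⟨i, hi⟩ ⟨j, hj⟩
    have e1 : μ i = a i * mp ⟨i, hi⟩ := dif_pos hi
    have e2 : μ j = -a j * mn ⟨j, hj⟩ := by
      simp only [μ]
      rw [dif_neg (not_lt.2 hj.le), dif_pos hj]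
    simp only [LinearMap.comp_apply, Y_ray, rayVec, LinearMap.sum_apply, LinearMap.smul_apply,
      LinearMap.proj_apply, Pi.add_apply, Pi.single_apply, smul_eq_mul, mul_add,
      Finset.sum_add_distrib, mul_ite, mul_zero, Finset.sum_ite_eq', Finset.mem_univ, if_true,
      e1, e2]
    ring

open Classical in
/-- The rays that lift the vertices of `P` are the vertices of an iterated pyramid over a prism,
up to scaling. -/
theorem exists_prism_of_card_eq_two (hvert : numVertices P = d + 4) (hκ : Fintype.card κ = d + 3)
    (hone : ∀ t t', t ∉ range (X.vertexRay ha) → t' ∉ range (X.vertexRay ha) → t = t')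
    (hinr : ∀ t, t ∉ range (X.vertexRay ha) → ∃ p, t = Sum.inr p)
    (hle : Fintype.card {i // 0 < a i} ≤ Fintype.card {i // a i < 0}) :
    2 ≤ d ∧ ∃ (x : (Fin 2 × Fin 3) ⊕ Fin (d - 2) → RayIdx a) (c : _ → ℝ),
      Function.Injective x ∧ range x = range (X.vertexRay ha) ∧ (∀ i, 0 < c i) ∧
      ∀ s t u, ∃ φ : V →ₗ[ℝ] ℝ, ∀ i, φ (X.ray ha (x i)) = c i * prismVal s t u i := by
  have hpart := card_sign_partition a
  set k := Fintype.card {i // a i = 0} with hk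
  set A := Fintype.card {i // 0 < a i} with hA
  set B := Fintype.card {i // a i < 0} with hB
  have hcard : Fintype.card (RayIdx a) = k + A * B := by
    rw [Fintype.card_sum, Fintype.card_prod]
  have hrange : (range (X.vertexRay ha)).ncard = d + 4 := by
    rw [← hvert, ← image_univ, ncard_image_of_injective _ (X.vertexRay_injective ha), ncard_univ]
    rfl
  have hcompl : (range (X.vertexRay ha)).ncard + (range (X.vertexRay ha))ᶜ.ncard = k + A * B := by
    rw [ncard_add_ncard_compl, Nat.card_eq_fintype_card, hcard]
  have hcompl1 : (range (X.vertexRay ha))ᶜ.ncard ≤ 1 :=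
    (ncard_le_one (toFinite _)).2 fun t ht t' ht' => hone t t' ht ht'
  -- (A-1)(B-1) is 2 or 3 and A ≤ B.
  have hA2 : A = 2 := by
    have h1 : A + B + 1 ≤ A * B := by omega
    have h2 : A * B ≤ A + B + 2 := by omega
    have h3 : 2 ≤ A := by
      by_contra h
      interval_cases A <;> omega
    by_contra h
    have h4 : 3 ≤ A := by omega
    nlinarith
  let e : Fin 2 ≃ {i // 0 < a i} := (Fintype.equivFinOfCardEq (hA ▸ hA2)).symm
  rw [hA2] at hcompl hpart
  have hpos : ∀ (i : {i // 0 < a i}) (j : {j // a j < 0}), 0 < -a j * a i := fun i j =>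
    mul_pos (neg_pos.2 j.2) i.2
  rcases Nat.le_one_iff_eq_zero_or_eq_one.1 hcompl1 with h0 | h1
  -- All rays are used: pairs form the prism, zero indices the d - 2 apices.
  · have hB3 : B = 3 := by omega
    have hk2 : k = d - 2 := by omega
    let f : Fin 3 ≃ {i // a i < 0} := (Fintype.equivFinOfCardEq (hB ▸ hB3)).symm
    let h : Fin (d - 2) ≃ {i // a i = 0} := (Fintype.equivFinOfCardEq (hk ▸ hk2)).symm
    have huniv : range (X.vertexRay ha) = univ := by
      rw [ncard_eq_zero (toFinite _), compl_empty_iff] at h0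
      exact h0
    refine ⟨by omega, (Equiv.sumCongr (Equiv.prodCongr e f) h).trans (Equiv.sumComm _ _),
      Sum.elim (fun p => -a (f p.2) * a (e p.1)) (fun _ => 1), Equiv.injective _, ?_, ?_, ?_⟩
    · rw [huniv, Equiv.range_eq_univ]
    · rintro (p | i)
      · exact hpos _ _
      · exact one_pos
    · intro s t u
      obtain ⟨φ, hφ0, hφ1⟩ := X.exists_functional_on_rays ha (u ∘ h.symm) (s ∘ e.symm) (t ∘ f.symm)
      refine ⟨φ, ?_⟩
      rintro (p | i)
      · simp [prismVal, hφ1]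
      · simp [prismVal, hφ0]
  -- The ray (i0, j0) is unused. The pairs avoiding j0 form the prism, and (i1, j0) joins the d - 3
  -- zero indices as an apex.
  · have hB4 : B = 4 := by omega
    have hk3 : Fintype.card (Option {i // a i = 0}) = d - 2 := by
      rw [Fintype.card_option]
      omega
    obtain ⟨t0, ht0⟩ := ncard_eq_one.1 h1
    have hran : range (X.vertexRay ha) = {t0}ᶜ := by rw [← ht0, compl_compl]
    obtain ⟨⟨i0, j0⟩, rfl⟩ := hinr t0 (by rw [hran]; simp)
    obtain ⟨i1, hi1, hi01⟩ : ∃ i1, i1 ≠ i0 ∧ ∀ i, i = i0 ∨ i = i1 := by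
      have : (Finset.univ : Finset {i // 0 < a i}).card = 2 := by rw [Finset.card_univ, ← hA, hA2]
      obtain ⟨y, z, hyz, hu⟩ := Finset.card_eq_two.1 this
      have hmem : ∀ i, i = y ∨ i = z := fun i => by
        have := Finset.mem_univ i
        rw [hu] at this
        simpa using this
      rcases hmem i0 with rfl | rfl
      · exact ⟨z, hyz.symm, hmem⟩
      · exact ⟨y, hyz, fun i => (hmem i).symm⟩
    let f : Fin 3 ≃ {j : {i // a i < 0} // j ≠ j0} := (Fintype.equivFinOfCardEq (by
      rw [Fintype.card_subtype_compl, Fintype.card_subtype_eq, ← hB, hB4])).symm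
    let h : Fin (d - 2) ≃ Option {i // a i = 0} := (Fintype.equivFinOfCardEq hk3).symm
    let ap : Option {i // a i = 0} → RayIdx a := fun o => o.elim (Sum.inr (i1, j0)) Sum.inl
    refine ⟨by omega, Sum.elim (fun p => Sum.inr (e p.1, (f p.2).1)) (ap ∘ h),
      Sum.elim (fun p => -a (f p.2).1 * a (e p.1))
        (fun i => (h i).elim (-a j0 * a i1) (fun _ => 1)), ?_, ?_, ?_, ?_⟩
    · rw [Sum.elim_injective]
      refine ⟨?_, ?_, ?_⟩
      · rintro ⟨p1, p2⟩ ⟨q1, q2⟩ hpq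
        simp only [Sum.inr.injEq, Prod.mk.injEq, EmbeddingLike.apply_eq_iff_eq] at hpq
        have := f.injective (Subtype.ext hpq.2)
        rw [hpq.1, this]
      · refine Function.Injective.comp ?_ h.injective
        rintro (_ | o) (_ | o') ho <;> simp_all [ap]
      · rintro ⟨p1, p2⟩ i hpi
        rcases hh : h i with _ | o
        · simp only [Function.comp_apply, hh, ap, Option.elim, Sum.inr.injEq, Prod.mk.injEq] at hpi
          exact (f p2).2 hpi.2
        · simp [hh, ap] at hpi
    · rw [hran]
      ext t
      simp only [mem_range, Sum.exists, Sum.elim_inl, Sum.elim_inr, mem_compl_iff,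
        mem_singleton_iff, Function.comp_apply]
      constructor
      · rintro (⟨p, rfl⟩ | ⟨i, rfl⟩)
        · intro hcon
          simp only [Sum.inr.injEq, Prod.mk.injEq] at hcon
          exact (f p.2).2 hcon.2
        · rcases hh : h i with _ | o
          · simpa [ap] using hi1
          · simp [ap]
      · intro ht
        rcases t with o | ⟨i, j⟩
        · right
          exact ⟨h.symm (some o), by simp [ap]⟩
        · by_cases hj : j = j0
          · right
            refine ⟨h.symm none, ?_⟩
            subst hj
            rcases hi01 i with rfl | rfl
            · exact absurd rfl ht
            · simp [ap]
          · left
            exact ⟨(e.symm i, f.symm ⟨j, hj⟩), by simp⟩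
    · rintro (p | i)
      · exact hpos _ _
      · rcases hh : h i with _ | o
        · simpa [hh] using hpos i1 j0
        · simp [hh]
    · intro s t u
      -- Only one used ray involves j0, so the parameter at j0 is free to give the apex (i1, j0) its
      -- prescribed value.
      obtain ⟨φ, hφ0, hφ1⟩ := X.exists_functional_on_rays ha (fun o => u (h.symm (some o)))
        (s ∘ e.symm) (fun j => if hj : j = j0 then u (h.symm none) - s (e.symm i1)
          else t (f.symm ⟨j, hj⟩))
      refine ⟨φ, ?_⟩
      rintro (p | i)
      · simp [prismVal, hφ1, (f p.2).2]
      · obtain ⟨o, rfl⟩ := h.symm.surjective i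
        rcases o with _ | o
        · simp [prismVal, ap, hφ1]
        · simp [prismVal, ap, hφ0]

end ConeExtension

/-! ### Face lattices from values of affine functionals. -/

/-- The sets of generators on the faces of the convex hull of the points `q i`. -/
def faceSets {E ι : Type*} [AddCommGroup E] [Module ℝ E] (q : ι → E) : Set (Set ι) :=
  {A | ∃ y : E × ℝ →ₗ[ℝ] ℝ, (∀ i, 0 ≤ y (homog (q i))) ∧ A = {i | y (homog (q i)) = 0}}

section FaceLattice

variable {E ι : Type*} [AddCommGroup E] [Module ℝ E] [TopologicalSpace E] {q : ι → E}

theorem IsFace.mem_faceSets [Fintype ι] {F : Set E} (hF : IsFace (convexHull ℝ (range q)) F) :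
    {i | q i ∈ F} ∈ faceSets q ∧ F = convexHull ℝ (q '' {i | q i ∈ F}) := by
  rcases F.eq_empty_or_nonempty with rfl | hne
  · refine ⟨⟨LinearMap.snd ℝ E ℝ, fun i => zero_le_one, ?_⟩, by simp⟩
    ext i
    simp [homog]
  · obtain ⟨y, hy, hFy⟩ := hF.exists_functional hne
    have hq : ∀ i, q i ∈ convexHull ℝ (range q) := fun i => subset_convexHull _ _ ⟨i, rfl⟩
    have hset : {i | q i ∈ F} = {i | y (homog (q i)) = 0} := by
      ext i
      rw [mem_ofPred_eq, hFy]
      exact ⟨fun h => h.2, fun h => ⟨hq i, h⟩⟩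
    refine ⟨⟨y, fun i => hy _ (hq i), hset⟩, subset_antisymm (fun x hx => ?_) ?_⟩
    · rw [hset]
      rw [hFy] at hx
      exact mem_convexHull_zeros (fun i => hy _ (hq i)) hx.1 hx.2
    · refine convexHull_min ?_ (hF.convex (convex_convexHull ℝ _))
      rintro _ ⟨i, hi, rfl⟩
      exact hi

theorem exists_isFace_of_mem_faceSets [IsTopologicalAddGroup E] [ContinuousSMul ℝ E] [T2Space E]
    [FiniteDimensional ℝ E] {A : Set ι} (hA : A ∈ faceSets q) :
    ∃ F, IsFace (convexHull ℝ (range q)) F ∧ {i | q i ∈ F} = A := by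
  obtain ⟨y, hy, rfl⟩ := hA
  refine ⟨_, isFace_of_functional (y := y) fun x hx => nonneg_on_convexHull ?_ hx, ?_⟩
  · rintro _ ⟨i, rfl⟩
    exact hy i
  · ext i
    exact ⟨fun h => h.2, fun h => ⟨subset_convexHull _ _ ⟨i, rfl⟩, h⟩⟩

/-- The face lattice of a polytope as a lattice of sets of generators. -/
noncomputable def faceLatticeIso [Fintype ι] [IsTopologicalAddGroup E] [ContinuousSMul ℝ E] [T2Space E]
    [FiniteDimensional ℝ E] (q : ι → E) :
    {F : Set E // IsFace (convexHull ℝ (range q)) F} ≃o faceSets q :=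
  let φ : {F : Set E // IsFace (convexHull ℝ (range q)) F} ↪o faceSets q :=
    OrderEmbedding.ofMapLEIff (fun F => ⟨{i | q i ∈ F.1}, F.2.mem_faceSets.1⟩) fun F G => by
      constructor
      · intro h
        have h' : {i | q i ∈ F.1} ⊆ {i | q i ∈ G.1} := h
        change F.1 ⊆ G.1
        rw [F.2.mem_faceSets.2, G.2.mem_faceSets.2]
        exact convexHull_mono (image_mono h')
      · intro h i hi
        exact h hi
  RelIso.ofSurjective φ fun A => by
    obtain ⟨F, hF, hFA⟩ := exists_isFace_of_mem_faceSets A.2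
    exact ⟨⟨F, hF⟩, Subtype.ext hFA⟩

end FaceLattice

/-- Positive rescaling of each generator changes neither signs nor zeros, so face sets depend only
on the attainable value vectors up to such scaling. -/
theorem faceSets_subset {E E' ι : Type*} [AddCommGroup E] [Module ℝ E] [AddCommGroup E']
    [Module ℝ E'] {q : ι → E} {w : ι → E'} {c : ι → ℝ} (hc : ∀ i, 0 < c i)
    (h : ∀ y : E × ℝ →ₗ[ℝ] ℝ, ∃ z : E' × ℝ →ₗ[ℝ] ℝ,
      ∀ i, y (homog (q i)) = c i * z (homog (w i))) : faceSets q ⊆ faceSets w := by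
  rintro _ ⟨y, hy, rfl⟩
  obtain ⟨z, hz⟩ := h y
  refine ⟨z, fun i => ?_, ?_⟩
  · have := hy i
    rw [hz] at this
    exact nonneg_of_mul_nonneg_right this (hc i)
  · ext i
    simp [hz, (hc i).ne']

/-- The vertices of the `n`-fold pyramid over the triangular prism. -/
noncomputable def pyrPrismVertex (n : ℕ) :
    (Fin 2 × Fin 3) ⊕ Fin n → ((Fin (1 + 1) → ℝ) × (Fin (2 + 1) → ℝ)) × (Fin n → ℝ) :=
  Sum.elim (fun p => ((Pi.single p.1 1, Pi.single p.2 1), 0)) (fun k => (0, Pi.single k 1))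

theorem pyr_prism_eq (n : ℕ) :
    pyr n (simplex 1 ×ˢ simplex 2) = convexHull ℝ (range (pyrPrismVertex n)) := by
  have h1 : ∀ n : ℕ, simplex n = convexHull ℝ (range fun i : Fin (n + 1) => Pi.single i (1 : ℝ)) := by
    intro n
    rw [simplex, ← convexHull_basis_eq_stdSimplex]
    congr 2
    ext i j
    simp [Pi.single_apply, eq_comm]
  have h2 : (simplex 1 ×ˢ simplex 2) = convexHull ℝ (range fun p : Fin 2 × Fin 3 =>
      ((Pi.single p.1 1 : Fin (1 + 1) → ℝ), (Pi.single p.2 1 : Fin (2 + 1) → ℝ))) := by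
    rw [h1, h1, ← convexHull_prod, prod_range_range_eq]
  have h3 : (fun x : (Fin (1 + 1) → ℝ) × (Fin (2 + 1) → ℝ) => (x, (0 : Fin n → ℝ))) =
      LinearMap.inl ℝ _ _ := rfl
  rw [pyr, h3, h2, LinearMap.image_convexHull, convexHull_convexHull_union_left, pyrPrismVertex,
    Sum.elim_range, ← range_comp]
  rfl

theorem exists_prismVal_eq {n : ℕ}
    (y : (((Fin (1 + 1) → ℝ) × (Fin (2 + 1) → ℝ)) × (Fin n → ℝ)) × ℝ →ₗ[ℝ] ℝ) :
    ∃ s t u, ∀ i, y (homog (pyrPrismVertex n i)) = prismVal s t u i := by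
  refine ⟨fun i => y (((Pi.single i 1, 0), 0), 0), fun j => y (((0, Pi.single j 1), 0), 1),
    fun k => y ((0, Pi.single k 1), 1), ?_⟩
  rintro (p | k)
  · simp only [prismVal, Sum.elim_inl, ← map_add]
    congr 1
    simp [homog, pyrPrismVertex]
  · rfl

theorem exists_eq_prismVal {n : ℕ} (s : Fin 2 → ℝ) (t : Fin 3 → ℝ) (u : Fin n → ℝ) :
    ∃ y : (((Fin (1 + 1) → ℝ) × (Fin (2 + 1) → ℝ)) × (Fin n → ℝ)) × ℝ →ₗ[ℝ] ℝ,
      ∀ i, y (homog (pyrPrismVertex n i)) = prismVal s t u i := by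
  refine ⟨(((∑ i, s i • (LinearMap.proj i : (Fin 2 → ℝ) →ₗ[ℝ] ℝ)).coprod
    (∑ i, t i • (LinearMap.proj i : (Fin 3 → ℝ) →ₗ[ℝ] ℝ))).coprod
    (∑ i, u i • (LinearMap.proj i : (Fin n → ℝ) →ₗ[ℝ] ℝ))).comp (LinearMap.fst ℝ _ ℝ), ?_⟩
  rintro (p | k)
  · simp [homog, pyrPrismVertex, prismVal, Pi.single_apply, -Fin.sum_univ_two]
  · simp [homog, pyrPrismVertex, prismVal, Pi.single_apply, -Fin.sum_univ_two]

/-- The linear map sending the parameters to the values, scaled by `c`. -/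
def prismMap (n : ℕ) (c : (Fin 2 × Fin 3) ⊕ Fin n → ℝ) :
    ((Fin 2 → ℝ) × (Fin 3 → ℝ) × (Fin n → ℝ)) →ₗ[ℝ] ((Fin 2 × Fin 3) ⊕ Fin n → ℝ) where
  toFun z i := c i * prismVal z.1 z.2.1 z.2.2 i
  map_add' z z' := by
    ext (p | k) <;> simp [prismVal] <;> ring
  map_smul' r z := by
    ext (p | k) <;> simp [prismVal] <;> ring

/-- There are n + 5 parameters, and the only ambiguity is shifting a constant between s and t. -/
theorem le_finrank_range_prismMap (n : ℕ) {c : (Fin 2 × Fin 3) ⊕ Fin n → ℝ} (hc : ∀ i, 0 < c i) :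
    n + 4 ≤ finrank ℝ (LinearMap.range (prismMap n c)) := by
  have h := LinearMap.finrank_range_add_finrank_ker (prismMap n c)
  simp only [finrank_prod, finrank_fin_fun] at h
  have hker : LinearMap.ker (prismMap n c) ≤
      Submodule.span ℝ {((fun _ => 1, fun _ => -1, 0) : (Fin 2 → ℝ) × (Fin 3 → ℝ) × (Fin n → ℝ))} := by
    rintro ⟨s, t, u⟩ hz
    have h0 : ∀ i, prismVal s t u i = 0 := fun i =>
      (mul_eq_zero.1 (congrFun (LinearMap.mem_ker.1 hz) i)).resolve_left (hc i).ne'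
    have h1 : ∀ i j, s i + t j = 0 := fun i j => h0 (Sum.inl (i, j))
    have h2 : ∀ k, u k = 0 := fun k => h0 (Sum.inr k)
    refine Submodule.mem_span_singleton.2 ⟨s 0, ?_⟩
    ext i
    · have := h1 i 0
      have := h1 0 0
      simp
      linarith
    · have := h1 0 i
      simp
      linarith
    · simp [h2]
  have h1 := Submodule.finrank_mono hker
  have h2 := finrank_span_le_card (R := ℝ)
    ({((fun _ => 1, fun _ => -1, 0) : (Fin 2 → ℝ) × (Fin 3 → ℝ) × (Fin n → ℝ))} : Set _)
  simp at h2
  omega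

/-- A point configuration in dimension `d + 1` on which affine functionals take, up to scaling, all
the values that they take on the vertices of the iterated pyramid over a prism. -/
theorem combEquiv_of_prismVal {d : ℕ} (hd : 2 ≤ d)
    {q : (Fin 2 × Fin 3) ⊕ Fin (d - 2) → (Fin (d + 1) → ℝ)} {c : _ → ℝ} (hc : ∀ i, 0 < c i)
    (hq : ∀ s t u, ∃ y : (Fin (d + 1) → ℝ) × ℝ →ₗ[ℝ] ℝ,
      ∀ i, y (homog (q i)) = c i * prismVal s t u i) :
    polyDim (convexHull ℝ (range q)) = d + 1 ∧
      CombEquiv (convexHull ℝ (range q)) (pyr (d - 2) (simplex 1 ×ˢ simplex 2)) := by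
  let ev : Dual ℝ ((Fin (d + 1) → ℝ) × ℝ) →ₗ[ℝ] ((Fin 2 × Fin 3) ⊕ Fin (d - 2) → ℝ) :=
    LinearMap.pi fun i => Dual.eval ℝ _ (homog (q i))
  have hev : ∀ y i, ev y i = y (homog (q i)) := fun y i => rfl
  have hle : LinearMap.range (prismMap (d - 2) c) ≤ LinearMap.range ev := by
    rintro _ ⟨⟨s, t, u⟩, rfl⟩
    obtain ⟨y, hy⟩ := hq s t u
    exact ⟨y, funext hy⟩
  have h1 := le_finrank_range_prismMap (d - 2) hc
  have h2 := LinearMap.finrank_range_add_finrank_ker ev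
  simp only [Subspace.dual_finrank_eq, finrank_prod, finrank_fin_fun, finrank_self] at h2
  have h3 := Submodule.finrank_mono hle
  -- Affine functionals on ℝ^(d+1) form a space of dimension d + 2, which the prism values already
  -- fill.
  have heq := Submodule.eq_of_le_of_finrank_le hle (by omega)
  have hinj : LinearMap.ker ev = ⊥ := Submodule.finrank_eq_zero.1 (by omega)
  constructor
  · have hspan : Submodule.span ℝ (homog '' range q) = ⊤ := by
      by_contra hne
      obtain ⟨f, hf, hfle⟩ := Submodule.exists_le_ker_of_lt_top _ (lt_top_iff_ne_top.2 hne)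
      apply hf
      have : f ∈ LinearMap.ker ev := by
        rw [LinearMap.mem_ker]
        ext i
        exact hfle (Submodule.subset_span ⟨q i, ⟨i, rfl⟩, rfl⟩)
      rwa [hinj, Submodule.mem_bot] at this
    have := polyDim_eq_finrank (convexHull ℝ (range q))
    rw [span_homog_convexHull, hspan, finrank_top] at this
    simp at this
    omega
  · have hsets : faceSets q = faceSets (pyrPrismVertex (d - 2)) := by
      apply subset_antisymm
      · refine faceSets_subset hc fun y => ?_
        have : ev y ∈ LinearMap.range (prismMap (d - 2) c) := by
          rw [heq]
          exact ⟨y, rfl⟩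
        obtain ⟨⟨s, t, u⟩, hstu⟩ := this
        obtain ⟨z, hz⟩ := exists_eq_prismVal s t u
        refine ⟨z, fun i => ?_⟩
        rw [hz, ← hev, ← hstu]
        rfl
      · refine faceSets_subset (fun i => inv_pos.2 (hc i)) fun z => ?_
        obtain ⟨s, t, u, hz⟩ := exists_prismVal_eq z
        obtain ⟨y, hy⟩ := hq s t u
        refine ⟨y, fun i => ?_⟩
        rw [hz, hy, inv_mul_cancel_left₀ (hc i).ne']
    rw [pyr_prism_eq]
    exact ⟨(faceLatticeIso q).trans ((OrderIso.setCongr _ _ hsets).trans (faceLatticeIso _).symm)⟩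

/-! ### Lifting the vertices of P to the polytope Q. -/

theorem convexHull_extremePoints_of_finite {d : ℕ} {P : Set (Fin d → ℝ)} (hP : IsPolytope P)
    (hfin : (P.extremePoints ℝ).Finite) : convexHull ℝ (P.extremePoints ℝ) = P := by
  obtain ⟨S, hS, rfl⟩ := hP
  have h := closure_convexHull_extremePoints (hS.isCompact_convexHull ℝ) (convex_convexHull ℝ S)
  rwa [(hfin.isCompact_convexHull ℝ).isClosed.closure_eq] at h

theorem polyDim_singleton {E : Type*} [AddCommGroup E] [Module ℝ E] (x : E) :
    polyDim ({x} : Set E) = 0 := by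
  rw [polyDim, if_pos (singleton_nonempty x), vectorSpan_singleton, finrank_bot]
  rfl

/-- If the generators of a polytope correspond under the projection to the vertices of `P`, then
the polytope projects onto `P` and all of its vertices are strictly preserved. -/
theorem isStrictlyPreserved_of_lift {d : ℕ} {P : Set (Fin d → ℝ)} (hP : IsPolytope P)
    (hvert : 2 ≤ numVertices P) {ι : Type*} [Fintype ι] {q : ι → (Fin (d + 1) → ℝ)}
    (hinj : Function.Injective fun i => forgetLast d (q i))
    (hrange : range (fun i => forgetLast d (q i)) = P.extremePoints ℝ) :
    forgetLast d '' convexHull ℝ (range q) = P ∧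
    ∀ v ∈ (convexHull ℝ (range q)).extremePoints ℝ,
      IsStrictlyPreserved (forgetLast d) (convexHull ℝ (range q)) {v} := by
  have himage : forgetLast d '' convexHull ℝ (range q) = P := by
    rw [LinearMap.image_convexHull, ← range_comp]
    change convexHull ℝ (range fun i => forgetLast d (q i)) = P
    rw [hrange]
    exact convexHull_extremePoints_of_finite hP (hrange ▸ finite_range _)
  refine ⟨himage, fun v hv => ?_⟩
  obtain ⟨i, rfl⟩ := extremePoints_convexHull_subset hv
  have hp : forgetLast d (q i) ∈ P.extremePoints ℝ := hrange ▸ ⟨i, rfl⟩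
  have hface := isFace_singleton_of_extreme hP hp
  obtain ⟨y, hy, hy0⟩ := hface.exists_functional (singleton_nonempty _)
  -- The functional exposing the vertex of P, pulled back, vanishes at only one generator because
  -- generators have distinct images.
  let y' : (Fin (d + 1) → ℝ) × ℝ →ₗ[ℝ] ℝ := y.comp ((forgetLast d).prodMap LinearMap.id)
  have hy' : ∀ x, y' (homog x) = y (homog (forgetLast d x)) := fun x => rfl
  have hmap : ∀ x ∈ convexHull ℝ (range q), forgetLast d x ∈ P := fun x hx =>
    himage ▸ mem_image_of_mem _ hx
  have hqi : q i ∈ convexHull ℝ (range q) := subset_convexHull _ _ ⟨i, rfl⟩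
  have hzero : ∀ x ∈ P, y (homog x) = 0 → x = forgetLast d (q i) := by
    intro x hx hx0
    have : x ∈ ({forgetLast d (q i)} : Set (Fin d → ℝ)) := by
      rw [hy0]
      exact ⟨hx, hx0⟩
    exact this
  have hi0 : y (homog (forgetLast d (q i))) = 0 := by
    have : forgetLast d (q i) ∈ ({forgetLast d (q i)} : Set (Fin d → ℝ)) := rfl
    rw [hy0] at this
    exact this.2
  have hset : {x ∈ convexHull ℝ (range q) | y' (homog x) = 0} = {q i} := by
    ext x
    constructor
    · rintro ⟨hx, hx0⟩
      have h := mem_convexHull_zeros (fun j => hy _ (hmap _ (subset_convexHull _ _ ⟨j, rfl⟩)))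
        (y := y') hx hx0
      have : q '' {j | y' (homog (q j)) = 0} ⊆ {q i} := by
        rintro _ ⟨j, hj, rfl⟩
        have hj' := hzero _ (hmap _ (subset_convexHull _ _ ⟨j, rfl⟩)) hj
        rw [hinj hj']
        rfl
      simpa using convexHull_mono this h
    · rintro rfl
      exact ⟨hqi, hi0⟩
  refine ⟨⟨?_, ?_, ?_, ?_⟩, ?_⟩
  · rw [← hset]
    exact isFace_of_functional fun x hx => hy _ (hmap x hx)
  · intro h
    rw [← h, image_singleton] at himage
    have h1 : P.extremePoints ℝ ⊆ {forgetLast d (q i)} := by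
      rw [himage]
      exact extremePoints_subset
    have := ncard_le_ncard h1 (finite_singleton _)
    rw [ncard_singleton] at this
    have h2 : numVertices P = (P.extremePoints ℝ).ncard := rfl
    omega
  · rw [image_singleton, himage]
    exact hface
  · rw [← hset, hset, image_singleton, ← hset]
    ext x
    constructor
    · rintro ⟨hx, hx'⟩
      have hx'' : forgetLast d x = forgetLast d (q i) := hx'
      exact ⟨hx, by rw [hy', hx'', hi0]⟩
    · rintro ⟨hx, hx0⟩
      exact ⟨hx, hzero _ (hmap x hx) hx0⟩
  · rw [image_singleton, polyDim_singleton, polyDim_singleton]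

theorem forgetLast_snoc {d : ℕ} (x : Fin d → ℝ) (b : ℝ) :
    forgetLast d (Fin.snoc x b : Fin (d + 1) → ℝ) = x := by
  ext i
  simp [forgetLast, LinearMap.funLeft_apply]

namespace ConeExtension

variable {d : ℕ} {P : Set (Fin d → ℝ)} {κ V : Type*} [AddCommGroup V] [Module ℝ V]
  [Fintype κ] (X : ConeExtension P κ V)
  {a : κ → ℝ} (ha : ∀ s : κ → ℝ, (∃ v, X.Y v = s) ↔ ∑ i, a i * s i = 0)

/-- A functional g with g l ≠ 0 supplies the coordinate lost by (π, τ). With it as height, the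
normalized used rays become points over the vertices of P, and Q is their hull. -/
theorem exists_polytope_of_prism (hP : IsPolytope P) (hvert : numVertices P = d + 4) (hd : 2 ≤ d)
    {l : V} (hl0 : l ≠ 0) (hl : ∀ v, X.π v = 0 → X.τ v = 0 → ∃ c : ℝ, v = c • l)
    {x : (Fin 2 × Fin 3) ⊕ Fin (d - 2) → RayIdx a} {c : _ → ℝ}
    (hinj : Function.Injective x) (hrange : range x = range (X.vertexRay ha)) (hc : ∀ i, 0 < c i)
    (hφ : ∀ s t u, ∃ φ : V →ₗ[ℝ] ℝ, ∀ i, φ (X.ray ha (x i)) = c i * prismVal s t u i) :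
    ∃ Q : Set (Fin (d + 1) → ℝ), IsPolytope Q ∧ polyDim Q = d + 1 ∧
      CombEquiv Q (pyr (d - 2) (simplex 1 ×ˢ simplex 2)) ∧ forgetLast d '' Q = P ∧
      ∀ v ∈ Q.extremePoints ℝ, IsStrictlyPreserved (forgetLast d) Q {v} := by
  obtain ⟨g, hg⟩ : ∃ g : Dual ℝ V, g l ≠ 0 := by
    by_contra h
    push Not at h
    exact hl0 ((forall_dual_apply_eq_zero_iff ℝ l).1 h)
  obtain ⟨σ, hσ⟩ := X.exists_section
  have hp : ∀ i, ∃ p, X.vertexRay ha p = x i := fun i => by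
    rw [← mem_range, ← hrange]
    exact ⟨i, rfl⟩
  choose p hp using hp
  have hπ : ∀ i, X.π (X.ray ha (x i)) = X.τ (X.ray ha (x i)) • (p i).1 := fun i => by
    rw [← hp]
    exact X.π_vertexRay ha (p i)
  have hτ : ∀ i, 0 < X.τ (X.ray ha (x i)) := fun i => X.τ_ray_pos ha (x i)
  let q : (Fin 2 × Fin 3) ⊕ Fin (d - 2) → (Fin (d + 1) → ℝ) := fun i =>
    Fin.snoc (p i).1 ((X.τ (X.ray ha (x i)))⁻¹ * g (X.ray ha (x i)))
  have hqp : ∀ i, forgetLast d (q i) = (p i).1 := fun i => forgetLast_snoc _ _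
  have hlift := isStrictlyPreserved_of_lift hP (by omega) (q := q)
    (by
      intro i j hij
      simp only [hqp] at hij
      apply hinj
      rw [← hp, ← hp, Subtype.ext hij])
    (by
      simp only [hqp]
      ext z
      constructor
      · rintro ⟨i, rfl⟩
        exact (p i).2
      · intro hz
        have : X.vertexRay ha ⟨z, hz⟩ ∈ range x := hrange ▸ ⟨⟨z, hz⟩, rfl⟩
        obtain ⟨i, hi⟩ := this
        refine ⟨i, ?_⟩
        rw [← hp] at hi
        exact congrArg Subtype.val (X.vertexRay_injective ha hi))
  have hcomb := combEquiv_of_prismVal hd (q := q)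
    (c := fun i => (X.τ (X.ray ha (x i)))⁻¹ * c i)
    (fun i => mul_pos (inv_pos.2 (hτ i)) (hc i)) (fun s t u => by
      obtain ⟨φ, hφ⟩ := hφ s t u
      set b := φ l / g l with hb
      have hbl : (φ - b • g) l = 0 := by
        simp [hb, div_mul_cancel₀ _ hg]
      -- As φ - b • g kills l, it factors through (π, τ); the last coordinate restores the summand b
      -- • g.
      let y : (Fin (d + 1) → ℝ) × ℝ →ₗ[ℝ] ℝ :=
        ((φ - b • g).comp σ).comp ((forgetLast d).prodMap LinearMap.id) +
          b • (LinearMap.proj (Fin.last d)).comp (LinearMap.fst ℝ _ ℝ)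
      refine ⟨y, fun i => ?_⟩
      obtain ⟨e, he⟩ := hl ((X.τ (X.ray ha (x i)))⁻¹ • X.ray ha (x i) - σ ((p i).1, 1))
        (by simp [hσ, hπ, smul_smul, (hτ i).ne']) (by simp [hσ, (hτ i).ne'])
      have h1 := congrArg (φ - b • g) he
      rw [map_smul, hbl, smul_zero, map_sub, sub_eq_zero, map_smul] at h1
      have h2 : y (homog (q i)) = (φ - b • g) (σ ((p i).1, 1)) + b * q i (Fin.last d) := by
        simp [y, homog, hqp]
      rw [h2, ← h1, mul_assoc, ← hφ]
      simp [q]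
      ring)
  exact ⟨_, ⟨_, finite_range q, rfl⟩, hcomb.1, hcomb.2, hlift.1, hlift.2⟩

theorem exists_polytope [FiniteDimensional ℝ V] (hP : IsPolytope P) (hd : 1 ≤ d)
    (hdim : polyDim P = d) (hvert : numVertices P = d + 4) (hfacet : d + 4 ≤ numFacets P)
    (hκ : Fintype.card κ = d + 3) (X : ConeExtension P κ V) :
    ∃ Q : Set (Fin (d + 1) → ℝ), IsPolytope Q ∧ polyDim Q = d + 1 ∧
      CombEquiv Q (pyr (d - 2) (simplex 1 ×ˢ simplex 2)) ∧ forgetLast d '' Q = P ∧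
      ∀ v ∈ Q.extremePoints ℝ, IsStrictlyPreserved (forgetLast d) Q {v} := by
  classical
  have h1 := X.finrank_le
  have h2 := X.le_finrank
  have hV : finrank ℝ V = d + 2 := by
    by_contra hne
    rcases (show finrank ℝ V = d + 1 ∨ finrank ℝ V = d + 3 by omega) with h | h
    · have : Nonempty κ := Fintype.card_pos_iff.1 (by omega)
      have hinj : Function.Injective (X.π.prod X.τ) :=
        (LinearMap.injective_iff_surjective_of_finrank_eq_finrank (by simpa using h)).2 X.surj
      have := X.numFacets_le_of_injective hd hdim hinj
      omega
    · have := X.numVertices_le (by omega)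
      omega
  obtain ⟨l, hl0, hπ, hτ, hl⟩ := X.exists_ker_generator hV
  obtain ⟨a, ha⟩ := X.exists_hyperplane (by omega)
  have key : ∀ (a : κ → ℝ), (∀ s : κ → ℝ, (∃ v, X.Y v = s) ↔ ∑ i, a i * s i = 0) →
      Fintype.card {i // 0 < a i} ≤ Fintype.card {i // a i < 0} →
      ∃ Q : Set (Fin (d + 1) → ℝ), IsPolytope Q ∧ polyDim Q = d + 1 ∧
        CombEquiv Q (pyr (d - 2) (simplex 1 ×ˢ simplex 2)) ∧ forgetLast d '' Q = P ∧
        ∀ v ∈ Q.extremePoints ℝ, IsStrictlyPreserved (forgetLast d) Q {v} := by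
    intro a ha hle
    obtain ⟨hone, hinr⟩ := X.notMem_range_vertexRay ha hd hdim hfacet hκ hl0 hπ hτ hl
    obtain ⟨hd2, x, c, hinj, hrange, hc, hφ⟩ :=
      X.exists_prism_of_card_eq_two ha hvert hκ hone hinr hle
    exact X.exists_polytope_of_prism ha hP hvert hd2 hl0 hl hinj hrange hc hφ
  rcases le_total (Fintype.card {i // 0 < a i}) (Fintype.card {i // a i < 0}) with hle | hle
  · exact key a ha hle
  -- Negating a describes the same hyperplane and swaps the two sign classes.
  · refine key (-a) (fun s => ?_) ?_
    · rw [ha]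
      simp
    · simpa using hle

end ConeExtension

end FewVertices

/-! ### The main theorem. -/

theorem mainTheorem7 (d : ℕ) (P : Set (Fin d → ℝ))
    (hP : FewVertices.IsPolytope P) (hdim : FewVertices.polyDim P = d)
    (hvert : FewVertices.numVertices P = d + 4)
    (hfacet : d + 4 ≤ FewVertices.numFacets P)
    (hxc : FewVertices.extensionComplexity P = d + 3) :
    ∃ Q : Set (Fin (d + 1) → ℝ),
      FewVertices.IsPolytope Q ∧
      FewVertices.polyDim Q = d + 1 ∧
      FewVertices.CombEquiv Q
        (FewVertices.pyr (d - 2) (FewVertices.simplex 1 ×ˢ FewVertices.simplex 2)) ∧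
      FewVertices.forgetLast d '' Q = P ∧
      ∀ v ∈ Q.extremePoints ℝ, FewVertices.IsStrictlyPreserved (FewVertices.forgetLast d) Q {v} := by
  have hd : 1 ≤ d := by
    by_contra h
    obtain rfl : d = 0 := by omega
    have h1 : (P.extremePoints ℝ).ncard ≤ 1 :=
      Set.ncard_le_one_of_subsingleton _
    have h2 : FewVertices.numVertices P = (P.extremePoints ℝ).ncard := rfl
    omega
  -- The infimum of the empty set is 0, so a positive extension complexity is attained.
  have hmem := Nat.sInf_mem (Nat.nonempty_of_pos_sInf (by
    change 0 < FewVertices.extensionComplexity P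
    omega))
  obtain ⟨m, R, f, hR, hf, hfac⟩ := hmem
  have hfac' : FewVertices.numFacets R = d + 3 := hfac.trans hxc
  -- `ncard` is 0 on infinite sets, so the nonzero count d + 3 yields finiteness.
  have hfin : {F | FewVertices.IsFacet R F}.Finite :=
    Set.finite_of_ncard_ne_zero (fun h => by
      have : FewVertices.numFacets R = 0 := h
      omega)
  have : Fintype {F // FewVertices.IsFacet R F} := hfin.fintype
  have hκ : Fintype.card {F // FewVertices.IsFacet R F} = d + 3 := by
    rw [← hfac', ← Nat.card_eq_fintype_card]
    rfl
  obtain ⟨X⟩ := FewVertices.exists_coneExtension hR hf hdim hd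
  exact X.exists_polytope hP hd hdim hvert hfacet hκ
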